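/- **Theorem (Structure of 2D $\infty$-harmonic maps).** Let $\Omega\subseteq\mathbb R^2$ be open, $N\ge 2$, and let $u\in C^2(\Omega)^N$ be an $\infty$-harmonic map, that is, for $\alpha=1,\dots,N$ (summation over repeated indices) $$D_iu_\alpha\,D_ju_\beta\,D^2_{ij}u_\beta+|Du|^2[Du]^\perp_{\alpha\beta}D^2_{ii}u_\beta=0\quad\text{on }\Omega ,$$ where $|Du|$ is the Euclidean norm of the gradient matrix and $[Du]^\perp$ is the orthogonal projection of $\mathbb R^N$ onto the nullspace of $Du^\top$. Put $\Omega_1=\operatorname{int}\{x\in\Omega:\operatorname{rk}Du\le 1\}$ and $\Omega_2=\{x\in\Omega:\operatorname{rk}Du=2\}$. Then $\Omega_1,\Omega_2$ are disjoint open sets, and $\Omega=\Omega_1\cup S\cup\Omega_2$ with a set $S$ that is disjoint from $\Omega_1\cup\Omega_2$, relatively closed in $\Omega$ and nowhere dense, such that: (i) On $\Omega_2$ the map $u$ is an immersion ($\operatorname{rk}Du=2$), and on each connected component of $\Omega_2$ it solves the vectorial Eikonal equation $|Du|^2=c^2$ for a constant $c>0$, which may depend on the component. (ii) At every $x\in\Omega_1$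 we have $\operatorname{rk}Du(x)=1$, unless $u$ is constant on the connected component of $\Omega$ that contains $x$. For each connected component $V$ of $\Omega_1$ there are $a\in\mathbb R^N$, $\xi\in\mathbb R^N$ with $|\xi|=1$, and a scalar function $f\in C^2(\Omega)$ such that $u=a+\xi f$ and $D_if\,D_jf\,D^2_{ij}f=0$ on $V$. The data $a,\xi,f$ may depend on $V$. (iii) On $S$ we have $\operatorname{rk}Du=1$, and $|Du|^2$ is a positive constant on each connected component of $\Omega_2\cup S$ (in particular, on each connected component of $S$). Moreover, $u$ is given by an essentially scalar solution of the Eikonal equation where the two phases meet: - for each connected component $V$ of $\Omega_1$, the $a,\xi,f$ of (ii) can be chosen so that also $u=a+\xi f$ and $Du=\xi\otimes Df$ on $S\cap\partial V$, and so that for each connected component $K$ of $\Omega_2\cup S$ there is $c>0$ with $|Df|^2=c^2$ on $K\cap S\cap\partial V$; - if $S=\Omega\cap\partial\Omega_1\cap\partial\Omega_2$ and every point of $S$ has a neighbourhood that meets only finitely many connected components of $\Omega_1$, then for each connected component $K$ of $S$ there are $a\in\mathbb R^N$, $\xi\in\mathbb R^N$ with $|\xi|=1$, $f\in C^2(\Omega)$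 and $c>0$ such that $u=a+\xi f$, $Du=\xi\otimes Df$ and $|Df|^2=c^2$ on $K$. -/

import Mathlib

open Set Filter Topology

noncomputable section

/-- The `i`-th partial derivative `D_i v (x)` of a map on `ℝⁿ`. -/
def partialD {n : ℕ} {F : Type*} [NormedAddCommGroup F] [NormedSpace ℝ F]
    (i : Fin n) (v : EuclideanSpace ℝ (Fin n) → F) (x : EuclideanSpace ℝ (Fin n)) : F :=
  fderiv ℝ v x (EuclideanSpace.single i 1)

/-- The squared Euclidean (Frobenius) norm `|Dv(x)|² = ∑_i |D_i v(x)|²` of the gradient matrix.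
For real-valued `v` this is the squared length of the gradient. -/
def gradNormSq {n : ℕ} {F : Type*} [NormedAddCommGroup F] [NormedSpace ℝ F]
    (v : EuclideanSpace ℝ (Fin n) → F) (x : EuclideanSpace ℝ (Fin n)) : ℝ :=
  ∑ i, ‖partialD i v x‖ ^ 2

/-- The range of the differential `Dv(x)`, as a subspace of the target. -/
def gradRange {n N : ℕ} (v : EuclideanSpace ℝ (Fin n) → EuclideanSpace ℝ (Fin N))
    (x : EuclideanSpace ℝ (Fin n)) : Submodule ℝ (EuclideanSpace ℝ (Fin N)) :=
  LinearMap.range (fderiv ℝ v x : EuclideanSpace ℝ (Fin n) →ₗ[ℝ] EuclideanSpace ℝ (Fin N))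

/-- The rank of the gradient matrix `Dv(x)`. -/
def gradRank {n N : ℕ} (v : EuclideanSpace ℝ (Fin n) → EuclideanSpace ℝ (Fin N))
    (x : EuclideanSpace ℝ (Fin n)) : ℕ :=
  Module.finrank ℝ (gradRange v x)

/-- The Laplacian `Δv = ∑_i D²_ii v`. -/
def laplace {n : ℕ} {F : Type*} [NormedAddCommGroup F] [NormedSpace ℝ F]
    (v : EuclideanSpace ℝ (Fin n) → F) (x : EuclideanSpace ℝ (Fin n)) : F :=
  ∑ i, partialD i (partialD i v) x

/-- The vectorial `∞`-Laplacian, in index form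
`D_i v_α D_j v_β D²_ij v_β + |Dv|² [Dv]^⊥_αβ D²_ii v_β`, where `[Dv]^⊥` is the orthogonal
projection on the nullspace of `Dvᵀ`, i.e. on the orthogonal complement of the range of `Dv`. -/
def infLaplacian {n N : ℕ} (v : EuclideanSpace ℝ (Fin n) → EuclideanSpace ℝ (Fin N))
    (x : EuclideanSpace ℝ (Fin n)) : EuclideanSpace ℝ (Fin N) :=
  (∑ i, ∑ j, inner ℝ (partialD j v x) (partialD i (partialD j v) x) • partialD i v x)
    + gradNormSq v x • (gradRange v x)ᗮ.starProjection (laplace v x)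

/-- The scalar `∞`-Laplacian `D_i f D_j f D²_ij f`. -/
def scalarInfLaplacian {n : ℕ} (f : EuclideanSpace ℝ (Fin n) → ℝ)
    (x : EuclideanSpace ℝ (Fin n)) : ℝ :=
  ∑ i, ∑ j, partialD i f x * partialD j f x * partialD i (partialD j f) x

/-- `v : Ω ⊆ ℝⁿ → ℝᴺ` is an `∞`-harmonic map: it is `C²` on `Ω` and a classical solution of the
`∞`-Laplacian system there. -/
def IsInfHarmonicMap {n N : ℕ} (Ω : Set (EuclideanSpace ℝ (Fin n)))
    (v : EuclideanSpace ℝ (Fin n) → EuclideanSpace ℝ (Fin N)) : Prop :=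
  ContDiffOn ℝ 2 v Ω ∧ ∀ x ∈ Ω, infLaplacian v x = 0

/-- `v = a + ξ f` at the point `y`, also to first order: `Dv(y) = ξ ⊗ Df(y)`. -/
def EssentiallyScalarAt {n N : ℕ} (v : EuclideanSpace ℝ (Fin n) → EuclideanSpace ℝ (Fin N))
    (a ξ : EuclideanSpace ℝ (Fin N)) (f : EuclideanSpace ℝ (Fin n) → ℝ)
    (y : EuclideanSpace ℝ (Fin n)) : Prop :=
  v y = a + f y • ξ ∧ ∀ w, fderiv ℝ v y w = fderiv ℝ f y w • ξ

end

/-! Write g = |Du|². The first term of the system lies in the range of Du and the second in its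
orthogonal complement, so both vanish: ∑ᵢ Dᵢg Dᵢu = 0 and g [Du]^⊥ Δu = 0. Where Du is injective,
the first equation gives Dg = 0. Three arguments do the rest.

Zeros of Du. Where Dg ≠ 0 the rank is one, say Du = ξ ⊗ a, and differentiating Dg · D⟨ξ,u⟩ = 0 gives
g the second derivative -|Dg|²/2 in the direction a. So certain paraboloids cannot touch g from
below (`IsInfHarmonicMap.not_isLocalMin_sub_barrier`), positivity of g spreads from a disc to a
larger one, and {Du = 0} is open (`IsInfHarmonicMap.eventually_gradNormSq_eq_zero`). Hence Du ≠ 0 on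
Ω₂ ∪ S.

Constancy of g. Dg = 0 on Ω₂, and on S ⊆ closure Ω₂ by continuity. Components of Ω₂ ∪ S need not be
open, and g is only C¹, too little for Morse-Sard in the plane. But g is a first integral of the C¹
fields D⟨ξ,u⟩, whose flow carries critical points, with their values, to a transversal line, where
the one-dimensional Sard theorem suffices. So g maps each component to a connected null set, a point
(`IsInfHarmonicMap.gradNormSq_eq_of_isPreconnected`).

Direction of Du. On Ω₁ the 2×2 minors of Du vanish. Where Du ≠ 0, their derivatives and the normal
equation make D²u parallel to ξ (`IsInfHarmonicMap.fderiv_fderiv_parallel`). So Du Duᵀ / g, the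
projection on ξ, is locally constant there; being continuous wherever Du ≠ 0, it carries the scalar
form of u to S. -/

theorem clm_apply_eq_sum {n : ℕ} {F : Type*} [NormedAddCommGroup F] [NormedSpace ℝ F]
    (L : EuclideanSpace ℝ (Fin n) →L[ℝ] F) (w : EuclideanSpace ℝ (Fin n)) :
    L w = ∑ i, w i • L (EuclideanSpace.single i 1) := by
  conv_lhs => rw [← (EuclideanSpace.basisFun (Fin n) ℝ).sum_repr w]
  simp [map_sum]

/-! ### Derivatives and rank of the gradient -/

section Calculus

variable {n N : ℕ} {Ω : Set (EuclideanSpace ℝ (Fin n))}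
  {u : EuclideanSpace ℝ (Fin n) → EuclideanSpace ℝ (Fin N)} {x : EuclideanSpace ℝ (Fin n)}

theorem contDiffOn_fderiv_of_contDiffOn_two {F : Type*} [NormedAddCommGroup F] [NormedSpace ℝ F]
    {v : EuclideanSpace ℝ (Fin n) → F} (hΩ : IsOpen Ω)
    (hv : ContDiffOn ℝ 2 v Ω) : ContDiffOn ℝ 1 (fderiv ℝ v) Ω :=
  hv.fderiv_of_isOpen hΩ (by norm_num)

theorem differentiableAt_fderiv {F : Type*} [NormedAddCommGroup F] [NormedSpace ℝ F]
    {v : EuclideanSpace ℝ (Fin n) → F} (hΩ : IsOpen Ω)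
    (hv : ContDiffOn ℝ 2 v Ω) (hx : x ∈ Ω) : DifferentiableAt ℝ (fderiv ℝ v) x :=
  ((contDiffOn_fderiv_of_contDiffOn_two hΩ hv).differentiableOn (by norm_num)).differentiableAt
    (hΩ.mem_nhds hx)

theorem hasFDerivAt_partialD {F : Type*} [NormedAddCommGroup F] [NormedSpace ℝ F]
    {v : EuclideanSpace ℝ (Fin n) → F} (hΩ : IsOpen Ω)
    (hv : ContDiffOn ℝ 2 v Ω) (hx : x ∈ Ω) (i : Fin n) :
    HasFDerivAt (partialD i v)
      ((fderiv ℝ (fderiv ℝ v) x).flip (EuclideanSpace.single i 1)) x :=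
  (ContinuousLinearMap.apply ℝ F (EuclideanSpace.single i (1 : ℝ))).hasFDerivAt.comp x
    (differentiableAt_fderiv hΩ hv hx).hasFDerivAt

theorem partialD_partialD {F : Type*} [NormedAddCommGroup F] [NormedSpace ℝ F]
    {v : EuclideanSpace ℝ (Fin n) → F} (hΩ : IsOpen Ω)
    (hv : ContDiffOn ℝ 2 v Ω) (hx : x ∈ Ω) (i j : Fin n) :
    partialD i (partialD j v) x =
      fderiv ℝ (fderiv ℝ v) x (EuclideanSpace.single i 1) (EuclideanSpace.single j 1) := by
  unfold partialD
  rw [show (fun y => fderiv ℝ v y (EuclideanSpace.single j 1)) = partialD j v from rfl,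
    (hasFDerivAt_partialD hΩ hv hx j).fderiv]
  rfl

theorem fderiv_fderiv_symm {F : Type*} [NormedAddCommGroup F] [NormedSpace ℝ F]
    {v : EuclideanSpace ℝ (Fin n) → F} (hΩ : IsOpen Ω)
    (hv : ContDiffOn ℝ 2 v Ω) (hx : x ∈ Ω) (w z : EuclideanSpace ℝ (Fin n)) :
    fderiv ℝ (fderiv ℝ v) x w z = fderiv ℝ (fderiv ℝ v) x z w :=
  ((hv.contDiffAt (hΩ.mem_nhds hx)).isSymmSndFDerivAt (by simp)).eq w z

theorem contDiffOn_partialD {F : Type*} [NormedAddCommGroup F] [NormedSpace ℝ F]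
    {v : EuclideanSpace ℝ (Fin n) → F} (hΩ : IsOpen Ω)
    (hv : ContDiffOn ℝ 2 v Ω) (i : Fin n) : ContDiffOn ℝ 1 (partialD i v) Ω :=
  (contDiffOn_fderiv_of_contDiffOn_two hΩ hv).clm_apply contDiffOn_const

theorem contDiffOn_gradNormSq (hΩ : IsOpen Ω) (hu : ContDiffOn ℝ 2 u Ω) :
    ContDiffOn ℝ 1 (gradNormSq u) Ω := by
  unfold gradNormSq
  exact ContDiffOn.sum fun i _ => (contDiffOn_partialD hΩ hu i).norm_sq ℝ

theorem differentiableAt_gradNormSq (hΩ : IsOpen Ω) (hu : ContDiffOn ℝ 2 u Ω) (hx : x ∈ Ω) :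
    DifferentiableAt ℝ (gradNormSq u) x :=
  ((contDiffOn_gradNormSq hΩ hu).differentiableOn (by norm_num)).differentiableAt (hΩ.mem_nhds hx)

theorem fderiv_gradNormSq (hΩ : IsOpen Ω) (hu : ContDiffOn ℝ 2 u Ω) (hx : x ∈ Ω)
    (w : EuclideanSpace ℝ (Fin n)) :
    fderiv ℝ (gradNormSq u) x w = 2 * ∑ j, inner ℝ (partialD j u x)
      (fderiv ℝ (fderiv ℝ u) x w (EuclideanSpace.single j 1)) := by
  have h : HasFDerivAt (gradNormSq u) (∑ i, (2 • (innerSL ℝ (partialD i u x)).comp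
      ((fderiv ℝ (fderiv ℝ u) x).flip (EuclideanSpace.single i 1)))) x := by
    unfold gradNormSq
    exact HasFDerivAt.fun_sum fun i _ => (hasFDerivAt_partialD hΩ hu hx i).norm_sq
  rw [h.fderiv]
  simp [Finset.mul_sum]

theorem gradNormSq_nonneg (u : EuclideanSpace ℝ (Fin n) → EuclideanSpace ℝ (Fin N))
    (x : EuclideanSpace ℝ (Fin n)) : 0 ≤ gradNormSq u x :=
  Finset.sum_nonneg fun _ _ => by positivity

theorem partialD_mem_gradRange (i : Fin n) : partialD i u x ∈ gradRange u x :=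
  ⟨EuclideanSpace.single i 1, rfl⟩

theorem gradNormSq_eq_zero_iff : gradNormSq u x = 0 ↔ fderiv ℝ u x = 0 := by
  unfold gradNormSq
  rw [Finset.sum_eq_zero_iff_of_nonneg fun _ _ => by positivity]
  refine ⟨fun h => ?_, fun h i _ => by simp [partialD, h]⟩
  ext1 w
  rw [clm_apply_eq_sum]
  refine Finset.sum_eq_zero fun i hi => ?_
  have : partialD i u x = 0 := by simpa using h i hi
  rw [show fderiv ℝ u x (EuclideanSpace.single i 1) = 0 from this, smul_zero]

theorem gradRank_eq_zero_iff : gradRank u x = 0 ↔ gradNormSq u x = 0 := by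
  rw [gradNormSq_eq_zero_iff]
  unfold gradRank gradRange
  rw [Submodule.finrank_eq_zero, LinearMap.range_eq_bot]
  exact ⟨fun h => by ext1 w; exact congrArg (fun L => L w) h, fun h => by rw [h]; rfl⟩

/-- A differential of rank at most one is supported on a line. -/
theorem exists_unit_of_gradRank_le_one (h1 : gradRank u x ≤ 1) (h0 : gradNormSq u x ≠ 0) :
    ∃ ξ : EuclideanSpace ℝ (Fin N), ‖ξ‖ = 1 ∧
      ∀ w, fderiv ℝ u x w = inner ℝ ξ (fderiv ℝ u x w) • ξ := by
  have h : gradRank u x = 1 := by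
    have := mt gradRank_eq_zero_iff.1 h0
    omega
  obtain ⟨⟨v, hv⟩, hv0, hsp⟩ := finrank_eq_one_iff'.1 h
  have hv0 : v ≠ 0 := fun h => hv0 (Subtype.ext h)
  have hn : ‖v‖ ≠ 0 := norm_ne_zero_iff.2 hv0
  refine ⟨‖v‖⁻¹ • v, by simp [norm_smul, hn], fun w => ?_⟩
  obtain ⟨c, hc⟩ := hsp ⟨fderiv ℝ u x w, ⟨w, rfl⟩⟩
  have hc : c • v = fderiv ℝ u x w := congrArg Subtype.val hc
  rw [← hc]
  simp only [inner_smul_left, inner_smul_right, real_inner_self_eq_norm_sq, smul_smul]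
  congr 1
  simp
  field_simp

theorem gradRank_le : gradRank u x ≤ n :=
  (LinearMap.finrank_range_le
    (fderiv ℝ u x : EuclideanSpace ℝ (Fin n) →ₗ[ℝ] EuclideanSpace ℝ (Fin N))).trans_eq
    finrank_euclideanSpace_fin

theorem injective_fderiv_iff : Function.Injective (fderiv ℝ u x) ↔ gradRank u x = n := by
  have h := LinearMap.finrank_range_add_finrank_ker
    (fderiv ℝ u x : EuclideanSpace ℝ (Fin n) →ₗ[ℝ] EuclideanSpace ℝ (Fin N))
  rw [finrank_euclideanSpace_fin] at h
  rw [show Function.Injective (fderiv ℝ u x) ↔ Function.Injective (fderiv ℝ u x :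
    EuclideanSpace ℝ (Fin n) →ₗ[ℝ] EuclideanSpace ℝ (Fin N)) from Iff.rfl,
    ← LinearMap.ker_eq_bot, ← Submodule.finrank_eq_zero]
  unfold gradRank gradRange
  omega

theorem isOpen_gradRank_eq (hΩ : IsOpen Ω) (hu : ContDiffOn ℝ 2 u Ω) :
    IsOpen {x | x ∈ Ω ∧ gradRank u x = n} := by
  have hc := (contDiffOn_fderiv_of_contDiffOn_two hΩ hu).continuousOn
  have h := hc.isOpen_inter_preimage hΩ
    (ContinuousLinearMap.isOpen_injective (𝕜 := ℝ) (E := EuclideanSpace ℝ (Fin n))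
      (F := EuclideanSpace ℝ (Fin N)))
  rwa [show Ω ∩ fderiv ℝ u ⁻¹' {L | Function.Injective ⇑L} = {x | x ∈ Ω ∧ gradRank u x = n} from
    Set.ext fun x => and_congr_right fun _ => injective_fderiv_iff] at h

/-! ### Tangential and normal parts of the system -/

section Equation

/-- The two terms of the system are orthogonal, so each vanishes; by the chain rule the first is
half of ∑ᵢ Dᵢ|Du|² Dᵢu. -/
theorem IsInfHarmonicMap.tangential_and_normal (hΩ : IsOpen Ω) (hu : IsInfHarmonicMap Ω u)
    (hx : x ∈ Ω) :
    ∑ i, fderiv ℝ (gradNormSq u) x (EuclideanSpace.single i 1) • partialD i u x = 0 ∧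
    gradNormSq u x • (gradRange u x)ᗮ.starProjection (laplace u x) = 0 := by
  have h := hu.2 x hx
  unfold infLaplacian at h
  have hT : (∑ i, ∑ j, inner ℝ (partialD j u x) (partialD i (partialD j u) x) • partialD i u x)
      = (1 / 2 : ℝ) • ∑ i, fderiv ℝ (gradNormSq u) x (EuclideanSpace.single i 1) •
        partialD i u x := by
    rw [Finset.smul_sum]
    refine Finset.sum_congr rfl fun i _ => ?_
    rw [fderiv_gradNormSq hΩ hu.1 hx, ← Finset.sum_smul, smul_smul]
    congr 1
    rw [← mul_assoc]
    norm_num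
    exact Finset.sum_congr rfl fun j _ => by rw [partialD_partialD hΩ hu.1 hx]
  rw [hT] at h
  set a := ∑ i, fderiv ℝ (gradNormSq u) x (EuclideanSpace.single i 1) • partialD i u x
  set b := gradNormSq u x • (gradRange u x)ᗮ.starProjection (laplace u x)
  have ha : a ∈ gradRange u x :=
    Submodule.sum_mem _ fun i _ => Submodule.smul_mem _ _ (partialD_mem_gradRange i)
  have hb : b ∈ (gradRange u x)ᗮ := Submodule.smul_mem _ _ (Submodule.starProjection_apply_mem _ _)
  have hab : inner ℝ a b = 0 := Submodule.inner_right_of_mem_orthogonal ha hb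
  have ha0 : a = 0 := by
    have h' := congrArg (fun z => inner ℝ a z) h
    simpa [inner_add_right, inner_smul_right, hab] using h'
  refine ⟨ha0, ?_⟩
  simpa [ha0] using h

theorem IsInfHarmonicMap.sum_fderiv_mul_inner (hΩ : IsOpen Ω) (hu : IsInfHarmonicMap Ω u)
    (hx : x ∈ Ω) (e : EuclideanSpace ℝ (Fin N)) :
    ∑ i, fderiv ℝ (gradNormSq u) x (EuclideanSpace.single i 1) * inner ℝ e (partialD i u x) = 0 := by
  have h := congrArg (fun z => inner ℝ e z) (hu.tangential_and_normal hΩ hx).1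
  simpa [inner_sum, inner_smul_right] using h

theorem IsInfHarmonicMap.fderiv_gradNormSq_eq_zero (hΩ : IsOpen Ω) (hu : IsInfHarmonicMap Ω u)
    (hx : x ∈ Ω) (hr : gradRank u x = n) : fderiv ℝ (gradNormSq u) x = 0 := by
  have hinj := injective_fderiv_iff.2 hr
  have h := (hu.tangential_and_normal hΩ hx).1
  have h2 : fderiv ℝ u x (∑ i, fderiv ℝ (gradNormSq u) x (EuclideanSpace.single i 1) •
      EuclideanSpace.single i (1 : ℝ)) = 0 := by
    simpa [map_sum, partialD] using h
  have h3 := hinj (h2.trans (map_zero _).symm)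
  ext1 w
  rw [clm_apply_eq_sum]
  refine Finset.sum_eq_zero fun i _ => ?_
  have := congrArg (fun z : EuclideanSpace ℝ (Fin n) => z i) h3
  simp [Finset.sum_apply, Pi.single_apply] at this
  simp [this]

end Equation

end Calculus

/-! ### Second derivative of |Du|² along the gradient -/

/-- A product rule in which `c` need only be continuous: as `d t = 0`, the difference quotient is `c
s` applied to that of `d`. -/
theorem hasDerivAt_clm_apply_of_eq_zero {E F : Type*} [NormedAddCommGroup E] [NormedSpace ℝ E]
    [NormedAddCommGroup F] [NormedSpace ℝ F] {c : ℝ → E →L[ℝ] F} {d : ℝ → E} {d' : E} {t : ℝ}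
    (hc : ContinuousAt c t) (hd : HasDerivAt d d' t) (h0 : d t = 0) :
    HasDerivAt (fun s => c s (d s)) (c t d') t := by
  rw [hasDerivAt_iff_tendsto_slope] at hd ⊢
  have h : slope (fun s => c s (d s)) t = fun s => c s (slope d t s) := by
    ext s
    simp [slope, h0]
  rw [h]
  have hc' : Tendsto c (𝓝[≠] t) (𝓝 (c t)) := hc.tendsto.mono_left nhdsWithin_le_nhds
  exact ((isBoundedBilinearMap_apply (𝕜 := ℝ) (E := E) (F := F)).continuous.tendsto
    (c t, d')).comp (hc'.prodMk_nhds hd)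

/-- A local minimum would also be a local maximum by the second derivative test, so φ would be
locally constant and c = 0. -/
theorem not_isLocalMin_of_deriv_deriv_neg {φ φ' : ℝ → ℝ} {t c : ℝ}
    (h1 : ∀ᶠ s in 𝓝 t, HasDerivAt φ (φ' s) s) (h2 : HasDerivAt φ' c t) (hc : c < 0) :
    ¬ IsLocalMin φ t := by
  intro hmin
  have he : deriv φ =ᶠ[𝓝 t] φ' := h1.mono fun s hs => hs.deriv
  have hd : deriv (deriv φ) t = c := by rw [he.deriv_eq, h2.deriv]
  have hmax := isLocalMax_of_deriv_deriv_neg (by rw [hd]; exact hc) hmin.deriv_eq_zero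
    h1.self_of_nhds.continuousAt
  have heq : φ =ᶠ[𝓝 t] fun _ => φ t := by
    filter_upwards [hmin, hmax] with s h h' using le_antisymm h' h
  have : deriv (deriv φ) t = 0 := by
    have h3 : deriv φ =ᶠ[𝓝 t] fun _ => 0 := by simpa using heq.deriv
    rw [h3.deriv_eq]; simp
  linarith

section

variable {n N : ℕ} {Ω : Set (EuclideanSpace ℝ (Fin n))}
  {u : EuclideanSpace ℝ (Fin n) → EuclideanSpace ℝ (Fin N)} {x : EuclideanSpace ℝ (Fin n)}

/-- The gradient of the component `⟨ξ, v⟩`. -/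
noncomputable def componentGrad (ξ : EuclideanSpace ℝ (Fin N))
    (v : EuclideanSpace ℝ (Fin n) → EuclideanSpace ℝ (Fin N)) (x : EuclideanSpace ℝ (Fin n)) :
    EuclideanSpace ℝ (Fin n) :=
  ∑ i, inner ℝ ξ (partialD i v x) • EuclideanSpace.single i (1 : ℝ)

theorem componentGrad_apply (ξ : EuclideanSpace ℝ (Fin N)) (i : Fin n) :
    componentGrad ξ u x i = inner ℝ ξ (partialD i u x) := by
  simp [componentGrad, Pi.single_apply]

theorem contDiffOn_componentGrad (hΩ : IsOpen Ω) (hu : ContDiffOn ℝ 2 u Ω)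
    (ξ : EuclideanSpace ℝ (Fin N)) : ContDiffOn ℝ 1 (componentGrad ξ u) Ω :=
  ContDiffOn.sum fun i _ =>
    (contDiffOn_const.inner ℝ (contDiffOn_partialD hΩ hu i)).smul contDiffOn_const

theorem hasFDerivAt_componentGrad (hΩ : IsOpen Ω) (hu : ContDiffOn ℝ 2 u Ω) (hx : x ∈ Ω)
    (ξ : EuclideanSpace ℝ (Fin N)) :
    HasFDerivAt (componentGrad ξ u) (∑ i, ((innerSL ℝ ξ).comp
      ((fderiv ℝ (fderiv ℝ u) x).flip (EuclideanSpace.single i 1))).smulRight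
        (EuclideanSpace.single i (1 : ℝ))) x := by
  unfold componentGrad
  refine HasFDerivAt.fun_sum fun i _ => ?_
  exact ((innerSL ℝ ξ).hasFDerivAt.comp x (hasFDerivAt_partialD hΩ hu hx i)).smul_const _

/-- Makes |Du|² a first integral of C¹ fields; both the barrier and the Sard argument rest on this.
-/
theorem IsInfHarmonicMap.fderiv_gradNormSq_componentGrad (hΩ : IsOpen Ω)
    (hu : IsInfHarmonicMap Ω u) (hx : x ∈ Ω) (ξ : EuclideanSpace ℝ (Fin N)) :
    fderiv ℝ (gradNormSq u) x (componentGrad ξ u x) = 0 := by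
  rw [← hu.sum_fderiv_mul_inner hΩ hx ξ, clm_apply_eq_sum]
  exact Finset.sum_congr rfl fun i _ => by rw [componentGrad_apply, smul_eq_mul, mul_comm]

theorem norm_sq_componentGrad {ξ : EuclideanSpace ℝ (Fin N)} (h1 : ‖ξ‖ = 1)
    (hξ : ∀ w, fderiv ℝ u x w = inner ℝ ξ (fderiv ℝ u x w) • ξ) :
    ‖componentGrad ξ u x‖ ^ 2 = gradNormSq u x := by
  rw [EuclideanSpace.norm_sq_eq]
  refine Finset.sum_congr rfl fun i _ => ?_
  rw [componentGrad_apply]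
  conv_rhs => rw [show partialD i u x = _ from hξ _]
  rw [norm_smul, h1, mul_one]
  rfl

/-- Along the direction of the gradient, `|Du|²` bends away from its own gradient. -/
theorem IsInfHarmonicMap.hasDerivAt_fderiv_gradNormSq_line (hΩ : IsOpen Ω)
    (hu : IsInfHarmonicMap Ω u) (hx : x ∈ Ω) {ξ : EuclideanSpace ℝ (Fin N)}
    (hξ : ∀ w, fderiv ℝ u x w = inner ℝ ξ (fderiv ℝ u x w) • ξ) :
    HasDerivAt (fun t : ℝ => fderiv ℝ (gradNormSq u) (x + t • componentGrad ξ u x)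
        (componentGrad ξ u x))
      (-(1 / 2) * ∑ i, fderiv ℝ (gradNormSq u) x (EuclideanSpace.single i 1) ^ 2) 0 := by
  set a := componentGrad ξ u x with ha
  have hline : HasDerivAt (fun t : ℝ => x + t • a) a 0 := by
    simpa using ((hasDerivAt_id (0 : ℝ)).smul_const a).const_add x
  have hx0 : x + (0 : ℝ) • a = x := by simp
  have hgC : ContinuousAt (fderiv ℝ (gradNormSq u)) x :=
    ((contDiffOn_gradNormSq hΩ hu.1).continuousOn_fderiv_of_isOpen hΩ le_rfl).continuousAt
      (hΩ.mem_nhds hx)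
  have hc : ContinuousAt (fun t : ℝ => fderiv ℝ (gradNormSq u) (x + t • a)) 0 :=
    ContinuousAt.comp (g := fderiv ℝ (gradNormSq u)) (by rwa [hx0]) hline.continuousAt
  have hd := ((hx0.symm ▸ hasFDerivAt_componentGrad hΩ hu.1 hx ξ :
    HasFDerivAt (componentGrad ξ u) _ (x + (0 : ℝ) • a)).comp_hasDerivAt (0 : ℝ) hline).sub_const a
  have h := (hasDerivAt_clm_apply_of_eq_zero hc hd (by simp [ha])).neg
  have hmem : ∀ᶠ t : ℝ in 𝓝 0, x + t • a ∈ Ω :=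
    hline.continuousAt.eventually_mem (by rw [hx0]; exact hΩ.mem_nhds hx)
  -- With g = |Du|² only C¹, Dg cannot be differentiated directly. Since Dg(A) = 0 for A =
  -- `componentGrad ξ u`, Dg(a) equals -Dg(A - a), where A - a is differentiable and vanishes at t =
  -- 0.
  refine HasDerivAt.congr_of_eventuallyEq ?_ (f := fun t : ℝ => -(fderiv ℝ (gradNormSq u)
    (x + t • a)) (componentGrad ξ u (x + t • a) - a)) ?_
  · refine h.congr_deriv ?_
    rw [hx0, clm_apply_eq_sum, ← neg_mul_eq_neg_mul, neg_inj, Finset.mul_sum]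
    refine Finset.sum_congr rfl fun i _ => ?_
    have hm : (∑ j, ((innerSL ℝ ξ).comp ((fderiv ℝ (fderiv ℝ u) x).flip
        (EuclideanSpace.single j 1))).smulRight (EuclideanSpace.single j (1 : ℝ))) a i =
        inner ℝ ξ (fderiv ℝ (fderiv ℝ u) x a (EuclideanSpace.single i 1)) := by
      simp [Pi.single_apply]
    -- DA(x) a = Dg(x)/2, by symmetry of D²u and Dⱼu(x) = aⱼ ξ.
    have hg : fderiv ℝ (gradNormSq u) x (EuclideanSpace.single i 1) =
        2 * inner ℝ ξ (fderiv ℝ (fderiv ℝ u) x a (EuclideanSpace.single i 1)) := by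
      rw [fderiv_gradNormSq hΩ hu.1 hx, fderiv_fderiv_symm hΩ hu.1 hx, clm_apply_eq_sum _ a,
        inner_sum]
      congr 1
      refine Finset.sum_congr rfl fun j _ => ?_
      rw [inner_smul_right, ha, componentGrad_apply]
      conv_lhs => rw [show partialD j u x = _ from hξ _]
      rw [inner_smul_left]
      rfl
    rw [hm, hg, smul_eq_mul]
    ring
  · filter_upwards [hmem] with t ht
    rw [map_sub, hu.fderiv_gradNormSq_componentGrad hΩ ht]
    simp
end

/-! ### Openness of the zero set of Du -/

section Planar

variable {N : ℕ} {Ω : Set (EuclideanSpace ℝ (Fin 2))}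
  {u : EuclideanSpace ℝ (Fin 2) → EuclideanSpace ℝ (Fin N)} {x y : EuclideanSpace ℝ (Fin 2)}

theorem IsInfHarmonicMap.gradRank_le_one (hΩ : IsOpen Ω) (hu : IsInfHarmonicMap Ω u) (hx : x ∈ Ω)
    (h : fderiv ℝ (gradNormSq u) x ≠ 0) : gradRank u x ≤ 1 := by
  have h1 := gradRank_le (u := u) (x := x)
  have h2 := mt (hu.fderiv_gradNormSq_eq_zero hΩ hx) h
  omega

/-- `|Du|²` cannot be touched from below by the rotationally symmetric barrier
`ε (R² - |x - y|²)` plus a negative constant. -/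
theorem IsInfHarmonicMap.not_isLocalMin_sub_barrier (hΩ : IsOpen Ω) (hu : IsInfHarmonicMap Ω u)
    (hx : x ∈ Ω) (hxy : x ≠ y) {ε R : ℝ} (hε : 0 < ε)
    (hR : R ^ 2 ≤ 2 * ‖x - y‖ ^ 2) (hlt : gradNormSq u x < ε * (R ^ 2 - ‖x - y‖ ^ 2)) :
    ¬ IsLocalMin (fun z => gradNormSq u z - ε * (R ^ 2 - ‖z - y‖ ^ 2)) x := by
  intro hmin
  have hgx := differentiableAt_gradNormSq hΩ hu.1 hx
  have hψ : ∀ z, HasFDerivAt (fun z => ε * (R ^ 2 - ‖z - y‖ ^ 2))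
      ((-(2 * ε)) • innerSL ℝ (z - y)) z := fun z => by
    refine ((((hasFDerivAt_id z).sub_const y).norm_sq).const_sub (R ^ 2)).const_mul ε
      |>.congr_fderiv ?_
    ext w
    simp
    ring
  have hD : ∀ w, fderiv ℝ (gradNormSq u) x w = -(2 * ε) * inner ℝ (x - y) w := by
    intro w
    have h := hmin.hasFDerivAt_eq_zero (hgx.hasFDerivAt.sub (hψ x))
    have h' := congrArg (fun L => L w) h
    rw [sub_apply, smul_apply, innerSL_apply_apply,
      smul_eq_mul, zero_apply] at h'
    linarith
  have hD0 : fderiv ℝ (gradNormSq u) x ≠ 0 := by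
    intro h
    have h' := hD (x - y)
    rw [h, real_inner_self_eq_norm_sq] at h'
    have : 0 < ‖x - y‖ := norm_pos_iff.2 (sub_ne_zero.2 hxy)
    have : 0 < ε * ‖x - y‖ ^ 2 := by positivity
    simp at h'
    rcases h' with h' | h' <;> simp_all
  have hg0 : gradNormSq u x ≠ 0 := by
    intro h
    have h' : IsLocalMin (gradNormSq u) x :=
      Filter.Eventually.of_forall fun z => h ▸ gradNormSq_nonneg u z
    exact hD0 h'.fderiv_eq_zero
  obtain ⟨ξ, hξ1, hξ⟩ := exists_unit_of_gradRank_le_one (hu.gradRank_le_one hΩ hx hD0) hg0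
  have h2 := hu.hasDerivAt_fderiv_gradNormSq_line hΩ hx hξ
  have ha2 := norm_sq_componentGrad hξ1 hξ
  have hDA := hu.fderiv_gradNormSq_componentGrad hΩ hx ξ
  set a := componentGrad ξ u x
  have hsum : ∑ i, fderiv ℝ (gradNormSq u) x (EuclideanSpace.single i 1) ^ 2 =
      4 * ε ^ 2 * ‖x - y‖ ^ 2 := by
    simp_rw [hD]
    rw [EuclideanSpace.norm_sq_eq, Finset.mul_sum]
    refine Finset.sum_congr rfl fun i _ => ?_
    simp [EuclideanSpace.inner_single_right]
    ring
  -- Dg is a nonzero multiple of x - y, and Dg(a) = 0: the line runs tangentially to the circle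
  -- around y.
  have hperp : inner ℝ (x - y) a = 0 := by
    rw [hD] at hDA
    have : (2 * ε) ≠ 0 := by positivity
    simpa [hε.ne'] using hDA
  have hline : ∀ t : ℝ, HasDerivAt (fun t : ℝ => x + t • a) a t := fun t => by
    simpa using ((hasDerivAt_id t).smul_const a).const_add x
  have hx0 : x + (0 : ℝ) • a = x := by simp
  have hmem : ∀ᶠ t : ℝ in 𝓝 0, x + t • a ∈ Ω :=
    (hline 0).continuousAt.eventually_mem (by rw [hx0]; exact hΩ.mem_nhds hx)
  have h1 : ∀ᶠ t : ℝ in 𝓝 0, HasDerivAt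
      (fun t : ℝ => gradNormSq u (x + t • a) - ε * (R ^ 2 - ‖x + t • a - y‖ ^ 2))
      (fderiv ℝ (gradNormSq u) (x + t • a) a + 2 * ε * ‖a‖ ^ 2 * t) t := by
    filter_upwards [hmem] with t ht
    have h := ((differentiableAt_gradNormSq hΩ hu.1 ht).hasFDerivAt.sub
      (hψ (x + t • a))).comp_hasDerivAt t (hline t)
    refine h.congr_deriv ?_
    have : inner ℝ (x + t • a - y) a = t * ‖a‖ ^ 2 := by
      rw [add_sub_right_comm, inner_add_left, hperp, inner_smul_left, real_inner_self_eq_norm_sq]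
      simp
    rw [sub_apply, smul_apply, innerSL_apply_apply,
      smul_eq_mul, this]
    ring
  have h3 : HasDerivAt (fun t : ℝ => fderiv ℝ (gradNormSq u) (x + t • a) a + 2 * ε * ‖a‖ ^ 2 * t)
      (-(1 / 2) * (4 * ε ^ 2 * ‖x - y‖ ^ 2) + 2 * ε * ‖a‖ ^ 2) 0 := by
    rw [hsum] at h2
    exact (h2.add ((hasDerivAt_id (0 : ℝ)).const_mul (2 * ε * ‖a‖ ^ 2))).congr_deriv (by simp)
  refine not_isLocalMin_of_deriv_deriv_neg h1 h3 ?_ ?_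
  -- Since |a|² = g(x), the second derivative is 2ε (g(x) - ε|x - y|²), while g(x) < ε (R² - |x -
  -- y|²) ≤ ε|x - y|².
  · rw [ha2]
    have : gradNormSq u x < ε * ‖x - y‖ ^ 2 := by nlinarith
    nlinarith
  · have hc : ContinuousAt (fun t : ℝ => x + t • a) 0 := (hline 0).continuousAt
    have h : IsLocalMin (fun z => gradNormSq u z - ε * (R ^ 2 - ‖z - y‖ ^ 2)) (x + (0 : ℝ) • a) := by
      rwa [hx0]
    exact hc.eventually h

/-- Positivity of `|Du|²` propagates from a disc to a larger concentric one. -/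
theorem IsInfHarmonicMap.gradNormSq_pos_of_closedBall (hΩ : IsOpen Ω) (hu : IsInfHarmonicMap Ω u)
    {r R : ℝ} (hr : 0 < r) (hR : R ^ 2 ≤ 2 * r ^ 2) (hsub : Metric.closedBall y R ⊆ Ω)
    (hrR : r ≤ R)
    (hpos : ∀ z ∈ Metric.closedBall y r, 0 < gradNormSq u z) (hx : x ∈ Metric.ball y R) :
    0 < gradNormSq u x := by
  have hgc := (contDiffOn_gradNormSq hΩ hu.1).continuousOn
  obtain ⟨q, hq, hqmin⟩ := (isCompact_closedBall y r).exists_isMinOn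
    ⟨y, Metric.mem_closedBall_self hr.le⟩
    (hgc.mono ((Metric.closedBall_subset_closedBall hrR).trans hsub))
  -- With εR² the minimum of g over the small disc, F ≥ 0 there and on the outer circle. A zero of g
  -- makes F negative, so its minimum lies inside the annulus, where the barrier lemma excludes it.
  set ε := gradNormSq u q / R ^ 2 with hεdef
  have hRpos : 0 < R := hr.trans_le hrR
  have hε : 0 < ε := div_pos (hpos q hq) (by positivity)
  have hεR : ε * R ^ 2 = gradNormSq u q := by rw [hεdef]; field_simp
  set F := fun z => gradNormSq u z - ε * (R ^ 2 - ‖z - y‖ ^ 2)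
  have hF : ContinuousOn F (Metric.closedBall y R) := (hgc.mono hsub).sub (by fun_prop)
  obtain ⟨p, hp, hpmin⟩ := (isCompact_closedBall y R).exists_isMinOn
    ⟨y, Metric.mem_closedBall_self hRpos.le⟩ hF
  by_contra hx0
  have hx0 : gradNormSq u x = 0 := le_antisymm (not_lt.1 hx0) (gradNormSq_nonneg u x)
  have hxn : ‖x - y‖ < R := by simpa [dist_eq_norm] using hx
  have hFx : F x < 0 := by
    have : 0 < R ^ 2 - ‖x - y‖ ^ 2 := by nlinarith [norm_nonneg (x - y)]
    have : 0 < ε * (R ^ 2 - ‖x - y‖ ^ 2) := by positivity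
    simp only [F, hx0]
    linarith
  have hFp : F p < 0 := (hpmin (Metric.ball_subset_closedBall hx)).trans_lt hFx
  have hpr : r < ‖p - y‖ := by
    by_contra hle
    have hp' : p ∈ Metric.closedBall y r := by simpa [dist_eq_norm] using hle
    have h1 : gradNormSq u q ≤ gradNormSq u p := hqmin hp'
    have : 0 ≤ ε * ‖p - y‖ ^ 2 := by positivity
    simp only [F] at hFp
    nlinarith
  have hpR : ‖p - y‖ < R := by
    refine lt_of_le_of_ne (by simpa [dist_eq_norm] using hp) fun h => ?_
    simp only [F, h] at hFp
    nlinarith [gradNormSq_nonneg u p]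
  refine hu.not_isLocalMin_sub_barrier (y := y) (R := R) hΩ (hsub hp) ?_ hε ?_ ?_
    (hpmin.isLocalMin ?_)
  · rintro rfl
    simp at hpr
    linarith
  · nlinarith
  · simp only [F] at hFp
    linarith
  · exact Filter.mem_of_superset (Metric.isOpen_ball.mem_nhds (by simpa [dist_eq_norm] using hpR))
      Metric.ball_subset_closedBall

/-- A critical point of a planar `∞`-harmonic map has a neighbourhood of critical points. -/
theorem IsInfHarmonicMap.eventually_gradNormSq_eq_zero (hΩ : IsOpen Ω) (hu : IsInfHarmonicMap Ω u)
    (hx : x ∈ Ω) (h0 : gradNormSq u x = 0) : ∀ᶠ y in 𝓝 x, gradNormSq u y = 0 := by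
  obtain ⟨ρ, hρ, hsub⟩ := Metric.isOpen_iff.1 hΩ x hx
  refine Metric.eventually_nhds_iff.2 ⟨ρ / 4, by positivity, fun y hy => ?_⟩
  by_contra hy0
  have hgc := (contDiffOn_gradNormSq hΩ hu.1).continuousOn
  have hypos : 0 < gradNormSq u y := lt_of_le_of_ne (gradNormSq_nonneg u y) (Ne.symm hy0)
  set Z := Metric.closedBall x (ρ / 2) ∩ {z | gradNormSq u z = 0} with hZ
  have hballΩ : Metric.closedBall x (ρ / 2) ⊆ Ω :=
    (Metric.closedBall_subset_ball (by linarith)).trans hsub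
  have hZc : IsCompact Z :=
    (isCompact_closedBall x (ρ / 2)).of_isClosed_subset
      ((hgc.mono hballΩ).preimage_isClosed_of_isClosed Metric.isClosed_closedBall
        (isClosed_singleton (x := (0 : ℝ)))) inter_subset_left
  have hxZ : x ∈ Z := ⟨Metric.mem_closedBall_self (by positivity), h0⟩
  obtain ⟨z, hz, hzd⟩ := hZc.exists_infDist_eq_dist ⟨x, hxZ⟩ y
  have hyz : 0 < dist y z := dist_pos.2 fun h => hy0 (h ▸ hz.2)
  have hyzx : dist y z ≤ dist y x := hzd ▸ Metric.infDist_le_dist_of_mem hxZ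
  set d := dist y z
  have hbig : Metric.closedBall y (6 / 5 * d) ⊆ Metric.ball x ρ := fun w hw => by
    have := dist_triangle w y x
    simp only [Metric.mem_closedBall, Metric.mem_ball] at hw ⊢
    linarith
  -- Here z is a zero nearest to y, so g > 0 within 9/10 d of y. The outer radius 6/5 d reaches past
  -- z, and (6/5)² = 1.44 ≤ 1.62 = 2 (9/10)².
  have hpos := hu.gradNormSq_pos_of_closedBall (y := y) (x := z) (r := 9 / 10 * d)
    (R := 6 / 5 * d) hΩ (by positivity) (by nlinarith) (hbig.trans hsub) (by linarith) ?_ ?_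
  · exact hpos.ne' hz.2
  · intro w hw
    refine lt_of_le_of_ne (gradNormSq_nonneg u w) fun hw0 => ?_
    simp only [Metric.mem_closedBall] at hw
    have hwZ : w ∈ Z := ⟨by
      have := dist_triangle w y x
      simp only [Metric.mem_closedBall]
      linarith, hw0.symm⟩
    have := Metric.infDist_le_dist_of_mem (x := y) hwZ
    rw [hzd, dist_comm y w] at this
    linarith
  · rw [Metric.mem_ball, dist_comm]
    change d < _
    linarith

theorem IsInfHarmonicMap.gradNormSq_eq_zero_on_component (hΩ : IsOpen Ω)
    (hu : IsInfHarmonicMap Ω u) (hx : x ∈ Ω) (h0 : gradNormSq u x = 0) :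
    ∀ y ∈ connectedComponentIn Ω x, gradNormSq u y = 0 := by
  have hgc := (contDiffOn_gradNormSq hΩ hu.1).continuousOn
  have hpos : IsOpen (Ω ∩ gradNormSq u ⁻¹' {0}ᶜ) :=
    hgc.isOpen_inter_preimage hΩ isOpen_compl_singleton
  have hzero : IsOpen (Ω ∩ {z | gradNormSq u z = 0}) := by
    rw [isOpen_iff_mem_nhds]
    rintro z ⟨hz, hz0⟩
    exact Filter.inter_mem (hΩ.mem_nhds hz) (hu.eventually_gradNormSq_eq_zero hΩ hz hz0)
  intro y hy
  have hsub := connectedComponentIn_subset Ω x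
  have := isPreconnected_connectedComponentIn.subset_left_of_subset_union hzero hpos
    (Set.disjoint_left.2 fun z hz hz' => hz'.2 hz.2) (fun z hz => by
      by_cases h : gradNormSq u z = 0
      · exact Or.inl ⟨hsub hz, h⟩
      · exact Or.inr ⟨hsub hz, h⟩) ⟨x, mem_connectedComponentIn hx, hx, h0⟩
  exact (this hy).2

theorem IsInfHarmonicMap.eq_on_component_of_gradNormSq_eq_zero (hΩ : IsOpen Ω)
    (hu : IsInfHarmonicMap Ω u) (hx : x ∈ Ω) (h0 : gradNormSq u x = 0) :
    ∀ y ∈ connectedComponentIn Ω x, u y = u x := by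
  intro y hy
  refine hΩ.connectedComponentIn.is_const_of_fderiv_eq_zero isPreconnected_connectedComponentIn
    ((hu.1.differentiableOn (by norm_num)).mono (connectedComponentIn_subset Ω x)) ?_ hy
    (mem_connectedComponentIn hx)
  intro z hz
  exact gradNormSq_eq_zero_iff.1 (hu.gradNormSq_eq_zero_on_component hΩ hx h0 z hz)

end Planar

/-! ### Local flows and transport of critical points -/

section Flow

variable {E : Type*} [NormedAddCommGroup E] [NormedSpace ℝ E]

open scoped NNReal in
/-- The solutions given by the Picard-Lindelöf theorem stay in the ball of definition. -/
theorem IsPicardLindelof.exists_hasDerivWithinAt_mem_closedBall [CompleteSpace E] {f : ℝ → E → E}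
    {tmin tmax : ℝ} {t₀ : Icc tmin tmax} {x₀ x : E} {a r L K : ℝ≥0}
    (hf : IsPicardLindelof f t₀ x₀ a r L K) (hx : x ∈ Metric.closedBall x₀ r) :
    ∃ α : ℝ → E, α t₀ = x ∧
      (∀ t ∈ Icc tmin tmax, HasDerivWithinAt α (f t (α t)) (Icc tmin tmax) t) ∧
      ∀ t, α t ∈ Metric.closedBall x₀ a := by
  obtain ⟨α, hα⟩ := ODE.FunSpace.exists_isFixedPt_next hf hx
  refine ⟨α.compProj, by rw [ODE.FunSpace.compProj_val, ← hα, ODE.FunSpace.next_apply₀],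
    fun t ht ↦ ?_, fun t => α.compProj_mem_closedBall hf.mul_max_le⟩
  apply ODE.hasDerivWithinAt_picard_Icc t₀.2 hf.continuousOn_uncurry
    α.continuous_compProj.continuousOn (fun _ ht' ↦ α.compProj_mem_closedBall hf.mul_max_le)
    x ht |>.congr_of_mem _ ht
  intro t' ht'
  nth_rw 1 [← hα]
  rw [ODE.FunSpace.compProj_of_mem ht', ODE.FunSpace.next_apply]

theorem eq_of_hasDerivWithinAt_of_fderiv_eq_zero {g : E → ℝ} {A : E → E} {α : ℝ → E} {a b c : ℝ}
    (hab : ∀ t ∈ Icc a b, HasDerivWithinAt α (A (α t)) (Icc a b) t)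
    (hg : ∀ t ∈ Icc a b, DifferentiableAt ℝ g (α t))
    (h0 : ∀ t ∈ Icc a b, fderiv ℝ g (α t) (A (α t)) = 0) {d : ℝ}
    (hc : c ∈ Icc a b) (hd : d ∈ Icc a b) : g (α c) = g (α d) := by
  have h : ∀ t ∈ Icc a b, HasDerivWithinAt (fun s => g (α s)) 0 (Icc a b) t := fun t ht => by
    have := (hg t ht).hasFDerivAt.comp_hasDerivWithinAt t (hab t ht)
    rwa [h0 t ht] at this
  have := (convex_Icc a b).norm_image_sub_le_of_norm_hasDerivWithin_le (C := 0) h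
    (fun t _ => by simp) hd hc
  simpa [sub_eq_zero] using this

open scoped NNReal in
/-- Two integral curves of an autonomous Lipschitz field, followed for the (signed) time `s`. -/
theorem dist_le_of_integralCurves {A : E → E} {K : ℝ≥0} {B : Set E} (hA : LipschitzOnWith K A B)
    {α β : ℝ → E} {t ε : ℝ} (hα : ∀ r ∈ Icc (-ε) ε, HasDerivWithinAt α (A (α r)) (Icc (-ε) ε) r)
    (hβ : ∀ r ∈ Icc (-ε) ε, HasDerivWithinAt β (A (β r)) (Icc (-ε) ε) r)
    (hαB : ∀ r, α r ∈ B) (hβB : ∀ r, β r ∈ B) (ht : |t| < ε) :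
    dist (α (-t)) (β 0) ≤ dist (α 0) (β t) * Real.exp (K * |t|) := by
  -- σ is a sign opposite to t; running both curves with velocity σ reduces either sign of t to
  -- Grönwall's inequality on [0, |t|].
  obtain ⟨σ, hσ, hσt⟩ : ∃ σ : ℝ, |σ| = 1 ∧ σ * |t| = -t := by
    rcases le_total 0 t with h | h
    · exact ⟨-1, by simp, by rw [abs_of_nonneg h]; ring⟩
    · exact ⟨1, by simp, by rw [abs_of_nonpos h]; ring⟩
  have key : ∀ r ∈ Icc 0 |t|, |σ * r| < ε ∧ |t + σ * r| < ε := by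
    intro r hr
    have h1 : |σ * r| < ε := by
      rw [abs_mul, hσ, one_mul, abs_of_nonneg hr.1]
      exact hr.2.trans_lt ht
    refine ⟨h1, ?_⟩
    have h2 : t + σ * r = -(σ * (|t| - r)) := by rw [mul_sub, hσt]; ring
    rw [h2, abs_neg, abs_mul, hσ, one_mul, abs_of_nonneg (by linarith [hr.2])]
    linarith [hr.1]
  have hd1 : ∀ r ∈ Icc 0 |t|, HasDerivAt (fun r => α (σ * r)) (σ • A (α (σ * r))) r := by
    intro r hr
    have h := (key r hr).1
    rw [abs_lt] at h
    have := (hα _ ⟨h.1.le, h.2.le⟩).hasDerivAt (Icc_mem_nhds h.1 h.2)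
    exact (this.scomp r ((hasDerivAt_id r).const_mul σ)).congr_deriv (by simp)
  have hd2 : ∀ r ∈ Icc 0 |t|, HasDerivAt (fun r => β (t + σ * r)) (σ • A (β (t + σ * r))) r := by
    intro r hr
    have h := (key r hr).2
    rw [abs_lt] at h
    have := (hβ _ ⟨h.1.le, h.2.le⟩).hasDerivAt (Icc_mem_nhds h.1 h.2)
    exact (this.scomp r (((hasDerivAt_id r).const_mul σ).const_add t)).congr_deriv (by simp)
  have hL : LipschitzOnWith K (fun z => σ • A z) B := by
    refine LipschitzOnWith.of_dist_le_mul fun z hz w hw => ?_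
    rw [dist_eq_norm, ← smul_sub, norm_smul, Real.norm_eq_abs, hσ, one_mul, ← dist_eq_norm]
    exact hA.dist_le_mul z hz w hw
  have := dist_le_of_trajectories_ODE_of_mem (v := fun _ z => σ • A z) (s := fun _ => B) (a := 0)
    (b := |t|) (fun _ _ => hL) (fun r hr => (hd1 r hr).continuousAt.continuousWithinAt)
    (fun r hr => (hd1 r (Ico_subset_Icc_self hr)).hasDerivWithinAt) (fun r _ => hαB _)
    (fun r hr => (hd2 r hr).continuousAt.continuousWithinAt)
    (fun r hr => (hd2 r (Ico_subset_Icc_self hr)).hasDerivWithinAt) (fun r _ => hβB _) le_rfl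
    |t| ⟨abs_nonneg t, le_rfl⟩
  simpa [hσt] using this

/-- A point is critical for `g` if `g` near it factors, at a linear rate, through `g` near a
critical point. -/
theorem hasFDerivAt_zero_of_le {g : E → ℝ} {x y : E} {C : ℝ} (hC : 0 < C)
    (hx : HasFDerivAt g (0 : E →L[ℝ] ℝ) x) (hxy : g y = g x)
    (h : ∀ᶠ z in 𝓝 y, ∃ z', g z' = g z ∧ dist z' x ≤ dist z y * C) :
    HasFDerivAt g (0 : E →L[ℝ] ℝ) y := by
  rw [hasFDerivAt_iff_isLittleO] at hx ⊢
  rw [Asymptotics.isLittleO_iff] at hx ⊢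
  intro c hc
  have hx := hx (show 0 < c / C by positivity)
  obtain ⟨δ, hδ, hx⟩ := Metric.eventually_nhds_iff.1 hx
  have hnear : ∀ᶠ z in 𝓝 y, dist z y * C < δ := by
    have : Tendsto (fun z => dist z y * C) (𝓝 y) (𝓝 (dist y y * C)) := by
      apply Continuous.tendsto
      fun_prop
    exact this.eventually_lt_const (by simpa using hδ)
  filter_upwards [h, hnear] with z ⟨z', hz', hd⟩ hz
  have := hx (hd.trans_lt hz)
  simp only [zero_apply, sub_zero] at this ⊢
  rw [hxy, ← hz']
  refine this.trans ?_
  rw [← dist_eq_norm, ← dist_eq_norm]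
  calc c / C * dist z' x ≤ c / C * (dist z y * C) := by gcongr
    _ = c * dist z y := by field_simp

open scoped NNReal in
/-- A local flow of a `C¹` field which stays in a prescribed neighbourhood. -/
theorem exists_localFlow_mem [CompleteSpace E] {V : E → E} {p : E} (hV : ContDiffAt ℝ 1 V p)
    {U : Set E} (hU : U ∈ 𝓝 p) :
    ∃ ε > (0 : ℝ), ∃ r > (0 : ℝ), ∃ K : ℝ≥0, ∃ B ⊆ U, LipschitzOnWith K V B ∧
      ∀ x ∈ Metric.closedBall p r, ∃ α : ℝ → E, α 0 = x ∧
        (∀ t ∈ Icc (-ε) ε, HasDerivWithinAt α (V (α t)) (Icc (-ε) ε) t) ∧ ∀ t, α t ∈ B := by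
  obtain ⟨ε, hε, a, r, L, K, hr, hPL⟩ := IsPicardLindelof.of_contDiffAt_one hV
  have h0 := hPL 0
  have har : (r : ℝ) ≤ a := by
    have h := h0.mul_max_le
    simp only [add_sub_cancel_left, sub_sub_cancel, max_self] at h
    have : 0 ≤ (L : ℝ) * ε := by positivity
    linarith
  have ha : 0 < a := hr.trans_le har
  obtain ⟨δ, hδ, hδU⟩ := Metric.nhds_basis_closedBall.mem_iff.1 hU
  set a' : ℝ≥0 := min a ⟨δ, hδ.le⟩ with ha'
  have ha'0 : 0 < a' := lt_min ha (by exact_mod_cast hδ)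
  obtain ⟨ε', hε', h1⟩ := h0.exists_shrink_radius hε (min_le_left a ⟨δ, hδ.le⟩)
    (half_lt_self ha'0)
  refine ⟨ε', hε', (a' / 2 : ℝ≥0), by positivity, K, Metric.closedBall p a', ?_, ?_, ?_⟩
  · exact (Metric.closedBall_subset_closedBall (min_le_right a ⟨δ, hδ.le⟩ : a' ≤ _)).trans hδU
  · exact h1.lipschitzOnWith 0 (by simp [hε'.le])
  · intro x hx
    obtain ⟨α, hα0, hα, hαB⟩ := h1.exists_hasDerivWithinAt_mem_closedBall hx
    simp only [zero_sub, zero_add] at hα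
    exact ⟨α, hα0, hα, hαB⟩

end Flow

/-! ### A Morse-Sard theorem for first integrals -/

section Sard

open MeasureTheory

local notation "E2" => EuclideanSpace ℝ (Fin 2)

/-- Critical points of a first integral of a `C¹` field can be transported along the field to a
transversal line. -/
theorem exists_nhds_transport_critical {Ω : Set E2} (hΩ : IsOpen Ω) {g : E2 → ℝ} {A : E2 → E2}
    (hg : DifferentiableOn ℝ g Ω) (hA : ContDiffOn ℝ 1 A Ω)
    (hgA : ∀ x ∈ Ω, fderiv ℝ g x (A x) = 0) {p : E2} (hp : p ∈ Ω) (hAp : A p ≠ 0) :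
    ∀ᶠ x in 𝓝 p, fderiv ℝ g x = 0 →
      ∃ y ∈ Ω, inner ℝ (A p) (y - p) = 0 ∧ fderiv ℝ g y = 0 ∧ g y = g x := by
  -- normalise the field, so that the height over the line grows at unit speed
  have hAt : ContDiffAt ℝ 1 A p := hA.contDiffAt (hΩ.mem_nhds hp)
  set h : E2 → ℝ := fun x => inner ℝ (A p) (A x)
  have hh : ContDiffAt ℝ 1 h p := contDiffAt_const.inner ℝ hAt
  have hhp : h p ≠ 0 := by
    change inner ℝ (A p) (A p) ≠ 0
    exact inner_self_ne_zero.2 hAp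
  set V : E2 → E2 := fun x => (h x)⁻¹ • A x with hV
  have hVp : ContDiffAt ℝ 1 V p := (hh.inv hhp).smul hAt
  have hU : {x | x ∈ Ω ∧ h x ≠ 0} ∈ 𝓝 p :=
    Filter.inter_mem (hΩ.mem_nhds hp) (hh.continuousAt.eventually_ne hhp)
  have hgV : ∀ x ∈ Ω, fderiv ℝ g x (V x) = 0 := fun x hx => by simp [hV, hgA x hx]
  obtain ⟨ε₁, hε₁, r₁, hr₁, K, B₁, hB₁, hL, hflow₁⟩ := exists_localFlow_mem hVp hU
  -- A smaller flow box, whose curves stay in the ball where the first flow starts: points near the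
  -- end of such a curve can then be flowed back.
  obtain ⟨ε₂, hε₂, r₂, hr₂, -, B₂, hB₂, -, hflow₂⟩ :=
    exists_localFlow_mem hVp (Metric.ball_mem_nhds p hr₁)
  have hr₁B : Metric.ball p r₁ ⊆ B₁ := fun z hz => by
    obtain ⟨γ, hγ0, -, hγB⟩ := hflow₁ z (Metric.ball_subset_closedBall hz)
    exact hγ0 ▸ hγB 0
  set ε := min ε₁ ε₂
  have hε : 0 < ε := lt_min hε₁ hε₂
  have hI₁ : Icc (-ε) ε ⊆ Icc (-ε₁) ε₁ :=
    Icc_subset_Icc (neg_le_neg (min_le_left _ _)) (min_le_left _ _)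
  have hI₂ : Icc (-ε) ε ⊆ Icc (-ε₂) ε₂ :=
    Icc_subset_Icc (neg_le_neg (min_le_right _ _)) (min_le_right _ _)
  have hw : ∀ᶠ x in 𝓝 p, |inner ℝ (A p) (x - p)| < ε := by
    have hc : Continuous fun x : E2 => |inner ℝ (A p) (x - p)| := by fun_prop
    exact (hc.tendsto p).eventually_lt_const (by simpa using hε)
  filter_upwards [hw, Metric.closedBall_mem_nhds p hr₂] with x hxw hxr hx0
  obtain ⟨α, hα0, hα, hαB⟩ := hflow₂ x hxr
  replace hα := fun t ht => (hα t (hI₂ ht)).mono hI₂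
  have hαB₁ : ∀ t, α t ∈ B₁ := fun t => hr₁B (hB₂ (hαB t))
  have hαΩ : ∀ t, α t ∈ Ω := fun t => (hB₁ (hαB₁ t)).1
  -- At unit speed, flowing for minus the height of x ends on the line of height zero.
  set t := -inner ℝ (A p) (x - p) with ht
  have htε : |t| < ε := by rwa [ht, abs_neg]
  have htI : t ∈ Icc (-ε) ε := ⟨(abs_lt.1 htε).1.le, (abs_lt.1 htε).2.le⟩
  have htI' : -t ∈ Icc (-ε) ε := ⟨by linarith [htI.2], by linarith [htI.1]⟩
  have h0I : (0 : ℝ) ∈ Icc (-ε) ε := ⟨by linarith, hε.le⟩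
  have hgd : ∀ z ∈ Ω, DifferentiableAt ℝ g z := fun z hz =>
    (hg z hz).differentiableAt (hΩ.mem_nhds hz)
  have hheight : inner ℝ (A p) (α t - p) = 0 := by
    have hd : ∀ s ∈ Icc (-ε) ε,
        HasDerivWithinAt (fun s => inner ℝ (A p) (α s - p) - s) 0 (Icc (-ε) ε) s := by
      intro s hs
      have h1 := ((innerSL ℝ (A p)).hasFDerivAt.comp_hasDerivWithinAt s
        ((hα s hs).sub_const p)).sub (hasDerivWithinAt_id s _)
      refine h1.congr_deriv ?_
      have := (hB₁ (hαB₁ s)).2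
      rw [innerSL_apply_apply, hV, inner_smul_right]
      change (h (α s))⁻¹ * h (α s) - 1 = 0
      rw [inv_mul_cancel₀ this, sub_self]
    have := (convex_Icc (-ε) ε).norm_image_sub_le_of_norm_hasDerivWithin_le (C := 0) hd
      (fun t _ => by simp) h0I htI
    simp only [zero_mul, norm_le_zero_iff, hα0] at this
    linarith
  refine ⟨α t, hαΩ t, hheight, ?_, ?_⟩
  -- Near α t, g factors through the backward flow to a neighbourhood of x, and Grönwall bounds the
  -- distances with factor exp(K|t|). So criticality is preserved although g is only differentiable.
  · refine (hasFDerivAt_zero_of_le (x := x) (Real.exp_pos (K * |t|)) ?_ ?_ ?_).fderiv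
    · exact hx0 ▸ (hgd x (hα0 ▸ hαΩ 0)).hasFDerivAt
    · rw [eq_of_hasDerivWithinAt_of_fderiv_eq_zero hα (fun s _ => hgd _ (hαΩ s))
        (fun s _ => hgV _ (hαΩ s)) htI h0I, hα0]
    · filter_upwards [Metric.isOpen_ball.mem_nhds (hB₂ (hαB t))] with z hz
      obtain ⟨γ, hγ0, hγ, hγB⟩ := hflow₁ z (Metric.ball_subset_closedBall hz)
      replace hγ := fun t ht => (hγ t (hI₁ ht)).mono hI₁
      have hγΩ : ∀ t, γ t ∈ Ω := fun t => (hB₁ (hγB t)).1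
      refine ⟨γ (-t), ?_, ?_⟩
      · rw [eq_of_hasDerivWithinAt_of_fderiv_eq_zero hγ (fun s _ => hgd _ (hγΩ s))
          (fun s _ => hgV _ (hγΩ s)) htI' h0I, hγ0]
      · have := dist_le_of_integralCurves hL hγ hα hγB hαB₁ htε
        rwa [hγ0, hα0] at this
  · rw [eq_of_hasDerivWithinAt_of_fderiv_eq_zero hα (fun s _ => hgd _ (hαΩ s))
      (fun s _ => hgV _ (hαΩ s)) htI h0I, hα0]

/-- Morse-Sard for first integrals of planar `C¹` fields, near a regular point of the field. -/
theorem exists_nhds_volume_image_critical_eq_zero {Ω : Set E2} (hΩ : IsOpen Ω) {g : E2 → ℝ}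
    {A : E2 → E2} (hg : DifferentiableOn ℝ g Ω) (hA : ContDiffOn ℝ 1 A Ω)
    (hgA : ∀ x ∈ Ω, fderiv ℝ g x (A x) = 0) {p : E2} (hp : p ∈ Ω) (hAp : A p ≠ 0) :
    ∃ U ∈ 𝓝 p, volume (g '' (U ∩ {x | fderiv ℝ g x = 0})) = 0 := by
  refine ⟨_, exists_nhds_transport_critical hΩ hg hA hgA hp hAp, ?_⟩
  -- A(p) turned by a right angle, spanning the transversal line.
  set n : E2 := !₂[-(A p 1), A p 0] with hn
  set T : Set ℝ := {s | p + s • n ∈ Ω ∧ fderiv ℝ g (p + s • n) = 0}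
  have hT : volume ((fun s : ℝ => g (p + s • n)) '' T) = 0 := by
    refine addHaar_image_eq_zero_of_det_fderivWithin_eq_zero volume
      (f' := fun _ => (0 : ℝ →L[ℝ] ℝ)) (fun s hs => ?_) (fun s _ => ?_)
    · have h1 : HasFDerivAt g (0 : E2 →L[ℝ] ℝ) (p + s • n) :=
        hs.2 ▸ ((hg _ hs.1).differentiableAt (hΩ.mem_nhds hs.1)).hasFDerivAt
      have h2 : HasFDerivAt (fun s : ℝ => p + s • n) _ s :=
        ((hasFDerivAt_id (𝕜 := ℝ) s).smul_const n).const_add p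
      exact (h1.comp s h2).hasFDerivWithinAt.congr_fderiv (ContinuousLinearMap.zero_comp _)
    · simp [ContinuousLinearMap.det]
  refine measure_mono_null ?_ hT
  rintro _ ⟨x, ⟨hx, hx0⟩, rfl⟩
  obtain ⟨y, hyΩ, hy, hy0, hyg⟩ := hx hx0
  have hnorm : A p 0 ^ 2 + A p 1 ^ 2 ≠ 0 := by
    intro h
    apply hAp
    ext i
    fin_cases i
    · simp; nlinarith [sq_nonneg (A p 0), sq_nonneg (A p 1)]
    · simp; nlinarith [sq_nonneg (A p 0), sq_nonneg (A p 1)]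
  have hy' : (y 0 - p 0) * A p 0 + (y 1 - p 1) * A p 1 = 0 := by
    simpa [PiLp.inner_apply, Fin.sum_univ_two] using hy
  obtain ⟨c, hyn⟩ : ∃ c : ℝ, y = p + c • n := by
    refine ⟨((y 1 - p 1) * A p 0 - (y 0 - p 0) * A p 1) / (A p 0 ^ 2 + A p 1 ^ 2), ?_⟩
    ext i
    fin_cases i
    · simp [hn]
      field_simp
      linear_combination A p 0 * hy'
    · simp [hn]
      field_simp
      linear_combination A p 1 * hy'
  subst hyn
  exact ⟨c, ⟨hyΩ, hy0⟩, hyg⟩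

/-- Two distinct values would put an interval of positive length into the image. -/
theorem IsPreconnected.eq_of_volume_image_eq_zero {X : Type*} [TopologicalSpace X] {K : Set X}
    (hK : IsPreconnected K) {g : X → ℝ} (hg : ContinuousOn g K) (h0 : volume (g '' K) = 0)
    {x y : X} (hx : x ∈ K) (hy : y ∈ K) : g x = g y := by
  wlog h : g x < g y generalizing x y
  · rcases lt_trichotomy (g x) (g y) with h' | h' | h'
    · exact absurd h' h
    · exact h'
    · exact (this hy hx h').symm
  have hsub := (hK.image g hg).Icc_subset (mem_image_of_mem g hx) (mem_image_of_mem g hy)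
  have := measure_mono_null hsub h0
  simp [Real.volume_Icc] at this
  linarith

theorem volume_image_eq_zero_of_locally {X : Type*} [TopologicalSpace X]
    [SecondCountableTopology X] {K : Set X} {g : X → ℝ}
    (h : ∀ p ∈ K, ∃ U ∈ 𝓝 p, volume (g '' (U ∩ K)) = 0) : volume (g '' K) = 0 := by
  choose! U hU hU0 using h
  obtain ⟨t, htK, htc, ht⟩ := TopologicalSpace.countable_cover_nhdsWithin
    (fun x hx => mem_nhdsWithin_of_mem_nhds (hU x hx))
  have hsub : g '' K ⊆ ⋃ p ∈ t, g '' (U p ∩ K) := by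
    rintro _ ⟨x, hx, rfl⟩
    obtain ⟨p, hp, hxp⟩ := mem_iUnion₂.1 (ht hx)
    exact mem_iUnion₂.2 ⟨p, hp, x, ⟨hxp, hx⟩, rfl⟩
  exact measure_mono_null hsub ((measure_biUnion_null_iff htc).2 fun p hp => hU0 p (htK hp))

variable {N : ℕ} {Ω : Set E2} {u : E2 → EuclideanSpace ℝ (Fin N)}

/-- `|Du|²` is constant on connected sets of its critical points. -/
theorem IsInfHarmonicMap.gradNormSq_eq_of_isPreconnected (hΩ : IsOpen Ω)
    (hu : IsInfHarmonicMap Ω u) {K : Set E2} (hK : IsPreconnected K) (hKΩ : K ⊆ Ω)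
    (hK0 : ∀ x ∈ K, fderiv ℝ (gradNormSq u) x = 0) (hpos : ∀ x ∈ K, gradNormSq u x ≠ 0)
    {x y : E2} (hx : x ∈ K) (hy : y ∈ K) : gradNormSq u x = gradNormSq u y := by
  have hg := (contDiffOn_gradNormSq hΩ hu.1).differentiableOn (by norm_num)
  refine hK.eq_of_volume_image_eq_zero (hg.continuousOn.mono hKΩ)
    (volume_image_eq_zero_of_locally fun p hp => ?_) hx hy
  obtain ⟨i, hi⟩ : ∃ i, partialD i u p ≠ 0 := by
    by_contra! h
    exact hpos p hp (Finset.sum_eq_zero fun i _ => by simp [h i])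
  -- Taking ξ = Dᵢu(p) makes the field nonzero at p: its i-th entry there is |Dᵢu(p)|².
  obtain ⟨U, hU, hU0⟩ := exists_nhds_volume_image_critical_eq_zero hΩ hg
    (contDiffOn_componentGrad hΩ hu.1 (partialD i u p))
    (fun x hx => hu.fderiv_gradNormSq_componentGrad hΩ hx _) (hKΩ hp) (fun h => by
      have := congrArg (fun z : E2 => z i) h
      simp [componentGrad_apply, hi] at this)
  exact ⟨U, hU, measure_mono_null
    (image_mono (inter_subset_inter_right U fun x hx => hK0 x hx)) hU0⟩

end Sard

/-! ### The direction of a gradient of rank one -/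

section Direction

variable {n N : ℕ} {Ω : Set (EuclideanSpace ℝ (Fin n))}
  {u : EuclideanSpace ℝ (Fin n) → EuclideanSpace ℝ (Fin N)} {x y : EuclideanSpace ℝ (Fin n)}
  {ξ : EuclideanSpace ℝ (Fin N)}

/-- The differential of `u` at `x` has its range in the line spanned by the unit vector `ξ`. -/
def GradParallel (u : EuclideanSpace ℝ (Fin n) → EuclideanSpace ℝ (Fin N))
    (ξ : EuclideanSpace ℝ (Fin N)) (x : EuclideanSpace ℝ (Fin n)) : Prop :=
  ∀ w, fderiv ℝ u x w = inner ℝ ξ (fderiv ℝ u x w) • ξ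

/-- The normalised operator `Du Duᵀ / |Du|²`, which for `Du` of rank one is the projection on
the range of `Du`. -/
noncomputable def tangentProj (u : EuclideanSpace ℝ (Fin n) → EuclideanSpace ℝ (Fin N))
    (v : EuclideanSpace ℝ (Fin N)) (x : EuclideanSpace ℝ (Fin n)) : EuclideanSpace ℝ (Fin N) :=
  (gradNormSq u x)⁻¹ • ∑ i, inner ℝ (partialD i u x) v • partialD i u x

theorem GradParallel.partialD_eq (h : GradParallel u ξ x) (i : Fin n) :
    partialD i u x = inner ℝ ξ (partialD i u x) • ξ := h _

theorem GradParallel.gradNormSq_eq (h : GradParallel u ξ x) (h1 : ‖ξ‖ = 1) :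
    gradNormSq u x = ∑ i, inner ℝ ξ (partialD i u x) ^ 2 := by
  refine Finset.sum_congr rfl fun i _ => ?_
  conv_lhs => rw [h.partialD_eq i]
  simp [norm_smul, h1]

theorem GradParallel.tangentProj_eq (h : GradParallel u ξ x) (h1 : ‖ξ‖ = 1)
    (h0 : gradNormSq u x ≠ 0) (v : EuclideanSpace ℝ (Fin N)) :
    tangentProj u v x = inner ℝ ξ v • ξ := by
  have : ∀ i, inner ℝ (partialD i u x) v • partialD i u x =
      (inner ℝ ξ (partialD i u x) ^ 2 * inner ℝ ξ v) • ξ := by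
    intro i
    conv_lhs => rw [h.partialD_eq i]
    rw [inner_smul_left, smul_smul]
    congr 1
    simp
    ring
  unfold tangentProj
  simp_rw [this]
  rw [← Finset.sum_smul, ← Finset.sum_mul, ← h.gradNormSq_eq h1, smul_smul]
  congr 1
  field_simp

/-- The projection determines the line, hence ξ up to sign, and the sign is immaterial for
`GradParallel`. -/
theorem gradParallel_of_tangentProj_eq (hr : gradRank u x ≤ 1) (h0 : gradNormSq u x ≠ 0)
    (h1 : ‖ξ‖ = 1) (h : ∀ v, tangentProj u v x = inner ℝ ξ v • ξ) : GradParallel u ξ x := by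
  obtain ⟨η, hη1, hη⟩ := exists_unit_of_gradRank_le_one hr h0
  have hη : GradParallel u η x := hη
  have h2 := h η
  rw [hη.tangentProj_eq hη1 h0, real_inner_self_eq_norm_sq, hη1] at h2
  simp only [one_pow, one_smul] at h2
  set c : ℝ := inner ℝ ξ η
  have hc : c * c = 1 := by
    have := congrArg norm h2
    rw [hη1, norm_smul, h1, mul_one, Real.norm_eq_abs] at this
    rw [← abs_mul_abs_self, ← this, one_mul]
  intro w
  conv_lhs => rw [hη w]
  rw [h2, inner_smul_left, smul_smul]
  congr 1
  simp only [conj_trivial]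
  linear_combination inner ℝ ξ (fderiv ℝ u x w) * hc

theorem continuousAt_tangentProj (hΩ : IsOpen Ω) (hu : ContDiffOn ℝ 2 u Ω) (hx : x ∈ Ω)
    (h0 : gradNormSq u x ≠ 0) {v : EuclideanSpace ℝ (Fin n) → EuclideanSpace ℝ (Fin N)}
    (hv : ContinuousAt v x) : ContinuousAt (fun y => tangentProj u (v y) y) x := by
  have hD : ∀ i, ContinuousAt (partialD i u) x := fun i =>
    (contDiffOn_partialD hΩ hu i).continuousOn.continuousAt (hΩ.mem_nhds hx)
  have hg := (contDiffOn_gradNormSq hΩ hu).continuousOn.continuousAt (hΩ.mem_nhds hx)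
  refine (hg.inv₀ h0).smul ?_
  exact tendsto_finsetSum _ fun i _ => Tendsto.smul (Tendsto.inner (hD i) hv) (hD i)

end Direction

/-! ### The direction is locally constant on the one-dimensional phase -/

section Planar

local notation "E2" => EuclideanSpace ℝ (Fin 2)

variable {N : ℕ} {Ω : Set E2} {u : E2 → EuclideanSpace ℝ (Fin N)} {x y : E2}
  {ξ : EuclideanSpace ℝ (Fin N)}

/-- Where the rank is at most one, the second derivatives are parallel to the gradient. -/
theorem IsInfHarmonicMap.fderiv_fderiv_parallel (hΩ : IsOpen Ω) (hu : IsInfHarmonicMap Ω u)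
    (hx : x ∈ Ω) (hr : ∀ᶠ y in 𝓝 x, gradRank u y ≤ 1) (h0 : gradNormSq u x ≠ 0) (h1 : ‖ξ‖ = 1)
    (hξ : GradParallel u ξ x) (w z : E2) :
    fderiv ℝ (fderiv ℝ u) x w z = inner ℝ ξ (fderiv ℝ (fderiv ℝ u) x w z) • ξ := by
  set B := fderiv ℝ (fderiv ℝ u) x with hB
  have key : ∀ e : EuclideanSpace ℝ (Fin N), inner ℝ ξ e = 0 → inner ℝ e (B w z) = 0 := by
    intro e he
    have hD : ∀ (e : EuclideanSpace ℝ (Fin N)) (i : Fin 2),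
        HasFDerivAt (fun y => inner ℝ e (partialD i u y))
        ((innerSL ℝ e).comp (B.flip (EuclideanSpace.single i 1))) x := fun e i =>
      (innerSL ℝ e).hasFDerivAt.comp x (hasFDerivAt_partialD hΩ hu.1 hx i)
    have he0 : ∀ i, inner ℝ e (partialD i u x) = 0 := fun i => by
      rw [hξ.partialD_eq i, inner_smul_right, real_inner_comm ξ e, he, mul_zero]
    -- A 2×2 minor of Du, vanishing near x by the rank bound. As e ⊥ ξ, only derivatives of the
    -- e-entries survive at x.
    have hwedge : (fun y => inner ℝ e (partialD 0 u y) * inner ℝ ξ (partialD 1 u y) -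
        inner ℝ e (partialD 1 u y) * inner ℝ ξ (partialD 0 u y)) =ᶠ[𝓝 x] fun _ => 0 := by
      filter_upwards [hr] with y hy
      by_cases hgy : gradNormSq u y = 0
      · rw [gradNormSq_eq_zero_iff] at hgy
        simp [partialD, hgy]
      · obtain ⟨η, hη1, hη⟩ := exists_unit_of_gradRank_le_one hy hgy
        have hη : GradParallel u η y := hη
        rw [hη.partialD_eq 0, hη.partialD_eq 1]
        simp only [inner_smul_right]
        ring
    have hder := hwedge.fderiv_eq (𝕜 := ℝ)
    have hder' : fderiv ℝ _ x = _ := (((hD e 0).mul (hD ξ 1)).sub ((hD e 1).mul (hD ξ 0))).fderiv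
    replace hder := hder'.symm.trans hder
    have hb : ∀ k, inner ℝ e (B k (EuclideanSpace.single 0 1)) * inner ℝ ξ (partialD 1 u x) =
        inner ℝ e (B k (EuclideanSpace.single 1 1)) * inner ℝ ξ (partialD 0 u x) := by
      intro k
      have := congrArg (fun L => L k) hder
      simp [he0] at this
      linarith
    have hlap : inner ℝ e (B (EuclideanSpace.single 0 1) (EuclideanSpace.single 0 1)) +
        inner ℝ e (B (EuclideanSpace.single 1 1) (EuclideanSpace.single 1 1)) = 0 := by
      have hn := (smul_eq_zero.1 (hu.tangential_and_normal hΩ hx).2).resolve_left h0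
      have heR : e ∈ (gradRange u x)ᗮ := by
        rw [Submodule.mem_orthogonal]
        rintro _ ⟨k, rfl⟩
        change inner ℝ (fderiv ℝ u x k) e = 0
        rw [hξ k, inner_smul_left, he, mul_zero]
      have h2 : inner ℝ e (laplace u x) = 0 := by
        rw [← Submodule.starProjection_eq_self_iff.2 heR,
          Submodule.inner_starProjection_left_eq_right, hn, inner_zero_right]
      simpa [laplace, Fin.sum_univ_two, partialD_partialD hΩ hu.1 hx, inner_add_right] using h2
    have hsym := fderiv_fderiv_symm hΩ hu.1 hx (EuclideanSpace.single 0 1) (EuclideanSpace.single 1 1)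
    have hg := hξ.gradNormSq_eq h1
    rw [Fin.sum_univ_two] at hg
    have hb0 := hb (EuclideanSpace.single 0 1)
    have hb1 := hb (EuclideanSpace.single 1 1)
    rw [← hB] at hsym
    rw [← hsym] at hb1
    set α₀ : ℝ := inner ℝ ξ (partialD 0 u x)
    set α₁ : ℝ := inner ℝ ξ (partialD 1 u x)
    set b₀₀ : ℝ := inner ℝ e (B (EuclideanSpace.single 0 1) (EuclideanSpace.single 0 1)) with hb₀₀
    set b₀₁ : ℝ := inner ℝ e (B (EuclideanSpace.single 0 1) (EuclideanSpace.single 1 1)) with hb₀₁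
    set b₁₁ : ℝ := inner ℝ e (B (EuclideanSpace.single 1 1) (EuclideanSpace.single 1 1)) with hb₁₁
    rw [hg] at h0
    -- The symmetric matrix b has rows parallel to α = D⟨ξ,u⟩ ≠ 0, so it is a multiple of α ⊗ α;
    -- being trace-free, it vanishes.
    have z₀₀ : b₀₀ = 0 := by
      refine (mul_eq_zero.1 (?_ : (α₀ ^ 2 + α₁ ^ 2) * b₀₀ = 0)).resolve_left h0
      linear_combination α₁ * hb0 + α₀ * hb1 + α₀ ^ 2 * hlap
    have z₁₁ : b₁₁ = 0 := by linarith
    have z₀₁ : b₀₁ = 0 := by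
      refine (mul_eq_zero.1 (?_ : (α₀ ^ 2 + α₁ ^ 2) * b₀₁ = 0)).resolve_left h0
      rw [z₀₀] at hb0
      rw [z₁₁] at hb1
      linear_combination α₁ * hb1 - α₀ * hb0
    rw [clm_apply_eq_sum (B w) z, clm_apply_eq_sum B w]
    have z₁₀ : inner ℝ e (B (EuclideanSpace.single 1 1) (EuclideanSpace.single 0 1)) = 0 := by
      rw [← hsym]; exact z₀₁
    simp only [Fin.sum_univ_two, add_apply, smul_apply,
      inner_add_right, inner_smul_right, ← hb₀₀, ← hb₀₁, ← hb₁₁, z₀₀, z₀₁, z₁₁, z₁₀]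
    ring
  set e := B w z - inner ℝ ξ (B w z) • ξ with he
  have he0 : inner ℝ ξ e = 0 := by
    rw [he, inner_sub_right, inner_smul_right, real_inner_self_eq_norm_sq, h1]
    ring
  have : inner ℝ e e = 0 := by
    conv_lhs => rw [he, inner_sub_right, inner_smul_right, ← he, key e he0, real_inner_comm ξ e, he0]
    ring
  exact sub_eq_zero.1 (inner_self_eq_zero.1 this)

/-- On the one-dimensional phase the direction of the gradient is locally constant. -/
theorem IsInfHarmonicMap.hasFDerivAt_inner_tangentProj (hΩ : IsOpen Ω) (hu : IsInfHarmonicMap Ω u)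
    (hx : x ∈ Ω) (hr : ∀ᶠ y in 𝓝 x, gradRank u y ≤ 1) (h0 : gradNormSq u x ≠ 0)
    (v w : EuclideanSpace ℝ (Fin N)) :
    HasFDerivAt (fun y => inner ℝ (tangentProj u v y) w) (0 : E2 →L[ℝ] ℝ) x := by
  obtain ⟨ξ, h1, hξ⟩ := exists_unit_of_gradRank_le_one hr.self_of_nhds h0
  have hξ : GradParallel u ξ x := hξ
  have hpar := hu.fderiv_fderiv_parallel hΩ hx hr h0 h1 hξ
  have hD : ∀ (e : EuclideanSpace ℝ (Fin N)) (i : Fin 2),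
      HasFDerivAt (fun y => inner ℝ e (partialD i u y)) ((innerSL ℝ e).comp
        ((fderiv ℝ (fderiv ℝ u) x).flip (EuclideanSpace.single i 1))) x := fun e i =>
    (innerSL ℝ e).hasFDerivAt.comp x (hasFDerivAt_partialD hΩ hu.1 hx i)
  have hnum := HasFDerivAt.fun_sum (u := Finset.univ) fun i _ => (hD v i).mul (hD w i)
  have hg := (differentiableAt_gradNormSq hΩ hu.1 hx).hasFDerivAt
  have h := ((hasDerivAt_inv h0).comp_hasFDerivAt x hg).mul hnum
  have heq : (fun y => inner ℝ (tangentProj u v y) w) = (gradNormSq u)⁻¹ *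
      fun y => ∑ i, (inner ℝ v (partialD i u y) * inner ℝ w (partialD i u y) : ℝ) := by
    ext y
    simp only [tangentProj, inner_smul_left, sum_inner, Pi.mul_apply, Pi.inv_apply]
    simp [real_inner_comm]
  rw [heq]
  refine h.congr_fderiv ?_
  ext k
  have hB : ∀ (e : EuclideanSpace ℝ (Fin N)) (i : Fin 2),
      inner ℝ e (fderiv ℝ (fderiv ℝ u) x k (EuclideanSpace.single i 1)) =
      inner ℝ ξ (fderiv ℝ (fderiv ℝ u) x k (EuclideanSpace.single i 1)) * inner ℝ e ξ := by
    intro e i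
    conv_lhs => rw [hpar, inner_smul_right]
  have hA : ∀ (e : EuclideanSpace ℝ (Fin N)) (i : Fin 2),
      inner ℝ e (partialD i u x) = inner ℝ ξ (partialD i u x) * inner ℝ e ξ := by
    intro e i
    conv_lhs => rw [hξ.partialD_eq i, inner_smul_right]
  have hgk := fderiv_gradNormSq hΩ hu.1 hx k
  have hg2 := hξ.gradNormSq_eq h1
  have hC : ∀ i, inner ℝ (partialD i u x) (fderiv ℝ (fderiv ℝ u) x k (EuclideanSpace.single i 1)) =
      inner ℝ ξ (partialD i u x) * inner ℝ ξ (fderiv ℝ (fderiv ℝ u) x k (EuclideanSpace.single i 1)) := by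
    intro i
    conv_lhs => rw [hξ.partialD_eq i, inner_smul_left]
    simp
  simp only [Fin.sum_univ_two, hC] at hgk hg2 ⊢
  simp only [add_apply, smul_apply, smul_eq_mul, ContinuousLinearMap.comp_apply, Pi.mul_apply,
    ContinuousLinearMap.flip_apply, innerSL_apply_apply, Function.comp_apply, zero_apply, hgk]
  rw [hA v 0, hA v 1, hA w 0, hA w 1, hB v 0, hB v 1, hB w 0, hB w 1]
  set G := gradNormSq u x
  field_simp
  rw [hg2]
  ring

end Planar

/-! ### Passing constant values to the interface -/

/-- Near a, the values other than F a form a finite, hence closed set, which F avoids close to a by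
continuity. No regularity of K is needed. -/
theorem IsPreconnected.eq_of_locally_finite_image {X Y : Type*} [TopologicalSpace X]
    [TopologicalSpace Y] [T1Space Y] {S K : Set X} (hK : IsPreconnected K) (hKS : K ⊆ S) {F : X → Y}
    (hF : ContinuousOn F S) (hfin : ∀ x ∈ S, ∃ W ∈ 𝓝 x, (F '' (S ∩ W)).Finite) {x y : X}
    (hx : x ∈ K) (hy : y ∈ K) : F x = F y := by
  refine hK.induction₂ (fun a b => F a = F b) (fun a ha => ?_) (fun a b c _ _ _ => Eq.trans)
    (fun a b _ _ => Eq.symm) hx hy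
  obtain ⟨W, hW, hWfin⟩ := hfin a (hKS ha)
  have hopen : ((F '' (S ∩ W)) \ {F a})ᶜ ∈ 𝓝 (F a) :=
    (hWfin.sdiff.isClosed.isOpen_compl).mem_nhds fun h => h.2 rfl
  have h1 := (hF.mono hKS a ha).eventually_mem hopen
  filter_upwards [h1, self_mem_nhdsWithin, mem_nhdsWithin_of_mem_nhds hW] with b hb hbK hbW
  by_contra hne
  exact hb ⟨⟨b, ⟨hKS hbK, hbW⟩, rfl⟩, fun h => hne h.symm⟩

theorem eq_of_mem_closure_of_continuousAt {X Y : Type*} [TopologicalSpace X] [TopologicalSpace Y]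
    [T1Space Y] {F : X → Y} {V : Set X} {c : Y} {y : X} (hF : ContinuousAt F y)
    (hy : y ∈ closure V) (h : ∀ z ∈ V, F z = c) : F y = c := by
  have h1 := hF.continuousWithinAt.mem_closure_image hy
  have h2 : F '' V ⊆ {c} := by
    rintro _ ⟨z, hz, rfl⟩
    exact h z hz
  simpa using closure_mono h2 h1

/-- A map which is constant on the components of `A` takes finitely many values near each point
of the boundary of `A`, if finitely many components come near. -/
theorem finite_image_of_finite_components {X Y : Type*} [TopologicalSpace X] [TopologicalSpace Y]
    [T1Space Y] [Nonempty Y] {F : X → Y} {A S W : Set X} (hF : ∀ y ∈ S, ContinuousAt F y) (hS : S ⊆ closure A)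
    (hconst : ∀ x ∈ A, ∀ y ∈ connectedComponentIn A x, F y = F x)
    (hfin : {V | (∃ x ∈ A, V = connectedComponentIn A x) ∧ (V ∩ W).Nonempty}.Finite) :
    (F '' (S ∩ interior W)).Finite := by
  set 𝒱 := {V | (∃ x ∈ A, V = connectedComponentIn A x) ∧ (V ∩ W).Nonempty}
  have hval : ∀ V ∈ 𝒱, ∃ c, ∀ z ∈ V, F z = c := by
    rintro V ⟨⟨x, hx, rfl⟩, -⟩
    exact ⟨F x, hconst x hx⟩
  choose! c hc using hval
  refine (hfin.image c).subset ?_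
  rintro _ ⟨y, ⟨hyS, hyW⟩, rfl⟩
  have hcl : y ∈ closure (A ∩ interior W) := by
    rw [mem_closure_iff_nhds]
    intro t ht
    obtain ⟨z, ⟨hzt, hzW⟩, hzA⟩ := mem_closure_iff_nhds.1 (hS hyS) (t ∩ interior W)
      (Filter.inter_mem ht (isOpen_interior.mem_nhds hyW))
    exact ⟨z, hzt, hzA, hzW⟩
  have hsub : A ∩ interior W ⊆ ⋃ V ∈ 𝒱, V := fun z hz => mem_iUnion₂.2
    ⟨connectedComponentIn A z, ⟨⟨z, hz.1, rfl⟩, z, mem_connectedComponentIn hz.1,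
      interior_subset hz.2⟩, mem_connectedComponentIn hz.1⟩
  have hcl' := closure_mono hsub hcl
  rw [hfin.closure_biUnion] at hcl'
  obtain ⟨V, hV, hyV⟩ := mem_iUnion₂.1 hcl'
  exact ⟨V, hV, (eq_of_mem_closure_of_continuousAt (hF y hyS) hyV (hc V hV)).symm⟩

/-! ### The scalar component ⟨ξ,u⟩ -/

section Components

variable {n N : ℕ} {Ω : Set (EuclideanSpace ℝ (Fin n))}
  {u : EuclideanSpace ℝ (Fin n) → EuclideanSpace ℝ (Fin N)} {x y : EuclideanSpace ℝ (Fin n)}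
  {ξ a : EuclideanSpace ℝ (Fin N)}

theorem fderiv_inner_component (hd : DifferentiableAt ℝ u x) (w : EuclideanSpace ℝ (Fin n)) :
    fderiv ℝ (fun z => inner ℝ ξ (u z)) x w = inner ℝ ξ (fderiv ℝ u x w) := by
  have : HasFDerivAt (fun z => inner ℝ ξ (u z)) ((innerSL ℝ ξ).comp (fderiv ℝ u x)) x :=
    (innerSL ℝ ξ).hasFDerivAt.comp x hd.hasFDerivAt
  rw [this.fderiv]
  rfl

theorem GradParallel.essentiallyScalarAt (h : GradParallel u ξ x) (hd : DifferentiableAt ℝ u x)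
    (ha : u x - inner ℝ ξ (u x) • ξ = a) :
    EssentiallyScalarAt u a ξ (fun z => inner ℝ ξ (u z)) x := by
  refine ⟨by rw [← ha]; simp, fun w => ?_⟩
  rw [fderiv_inner_component hd]
  exact h w

theorem GradParallel.gradNormSq_component (h : GradParallel u ξ x) (h1 : ‖ξ‖ = 1)
    (hd : DifferentiableAt ℝ u x) :
    gradNormSq (fun z => inner ℝ ξ (u z)) x = gradNormSq u x := by
  rw [h.gradNormSq_eq h1]
  refine Finset.sum_congr rfl fun i _ => ?_
  rw [partialD, fderiv_inner_component hd, Real.norm_eq_abs, sq_abs]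
  rfl

/-- Where Du is parallel to ξ, half of D|Du|² is the Hessian of ⟨ξ,u⟩ applied to its gradient, so
the tangential equation paired with ξ is the scalar one. -/
theorem IsInfHarmonicMap.scalarInfLaplacian_component (hΩ : IsOpen Ω) (hu : IsInfHarmonicMap Ω u)
    (hx : x ∈ Ω) (h : GradParallel u ξ x) :
    scalarInfLaplacian (fun z => inner ℝ ξ (u z)) x = 0 := by
  have hd : ∀ z ∈ Ω, DifferentiableAt ℝ u z := fun z hz =>
    (hu.1.differentiableOn (by norm_num)).differentiableAt (hΩ.mem_nhds hz)
  have h1 : ∀ z ∈ Ω, ∀ j, partialD j (fun z => inner ℝ ξ (u z)) z = inner ℝ ξ (partialD j u z) :=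
    fun z hz j => fderiv_inner_component (hd z hz) _
  have h2 : ∀ i j, partialD i (partialD j (fun z => inner ℝ ξ (u z))) x =
      inner ℝ ξ (partialD i (partialD j u) x) := by
    intro i j
    have heq : partialD j (fun z => inner ℝ ξ (u z)) =ᶠ[𝓝 x] fun z => inner ℝ ξ (partialD j u z) := by
      filter_upwards [hΩ.mem_nhds hx] with z hz using h1 z hz j
    unfold partialD at heq ⊢
    rw [heq.fderiv_eq]
    exact fderiv_inner_component (hasFDerivAt_partialD hΩ hu.1 hx j).differentiableAt _
  have h3 := hu.sum_fderiv_mul_inner hΩ hx ξ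
  have h4 : ∀ i, fderiv ℝ (gradNormSq u) x (EuclideanSpace.single i 1) =
      2 * ∑ j, inner ℝ ξ (partialD j u x) * inner ℝ ξ (partialD i (partialD j u) x) := by
    intro i
    rw [fderiv_gradNormSq hΩ hu.1 hx]
    congr 1
    refine Finset.sum_congr rfl fun j _ => ?_
    conv_lhs => rw [h.partialD_eq j, inner_smul_left, ← partialD_partialD hΩ hu.1 hx]
    rfl
  unfold scalarInfLaplacian
  simp_rw [h2, h1 x hx]
  simp_rw [h4, mul_assoc, ← Finset.mul_sum] at h3
  have h5 := (mul_eq_zero.1 h3).resolve_left two_ne_zero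
  rw [← h5]
  refine Finset.sum_congr rfl fun i _ => ?_
  rw [mul_comm, Finset.mul_sum]
  exact Finset.sum_congr rfl fun j _ => mul_assoc _ _ _

end Components

/-! ### Scalar form on components and at their boundary -/

section Planar

local notation "E2" => EuclideanSpace ℝ (Fin 2)

variable {N : ℕ} {Ω : Set E2} {u : E2 → EuclideanSpace ℝ (Fin N)} {x y : E2}
  {ξ : EuclideanSpace ℝ (Fin N)}

theorem IsInfHarmonicMap.gradNormSq_ne_zero_on_component (hΩ : IsOpen Ω)
    (hu : IsInfHarmonicMap Ω u) (h0 : gradNormSq u x ≠ 0)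
    (hy : y ∈ connectedComponentIn Ω x) : gradNormSq u y ≠ 0 := by
  intro hy0
  have hxΩ : x ∈ Ω := connectedComponentIn_nonempty_iff.1 ⟨y, hy⟩
  exact h0 (hu.gradNormSq_eq_zero_on_component hΩ (connectedComponentIn_subset _ _ hy) hy0 x
    (connectedComponentIn_eq hy ▸ mem_connectedComponentIn hxΩ))

/-- The data of the line containing the values of `u` are constant on connected open sets of rank
at most one. -/
theorem IsInfHarmonicMap.tangentProj_eq_of_component (hΩ : IsOpen Ω) (hu : IsInfHarmonicMap Ω u)
    {A : Set E2} (hA : IsOpen A) (hAΩ : A ⊆ Ω) (hr : ∀ z ∈ A, gradRank u z ≤ 1)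
    (hx : x ∈ A) (hy : y ∈ connectedComponentIn A x) (v : EuclideanSpace ℝ (Fin N)) :
    tangentProj u v y = tangentProj u v x := by
  have hsub := connectedComponentIn_mono x hAΩ
  by_cases h0 : gradNormSq u x = 0
  · have hy0 := hu.gradNormSq_eq_zero_on_component hΩ (hAΩ hx) h0 y (hsub hy)
    simp [tangentProj, h0, hy0]
  · refine ext_inner_right ℝ fun w => ?_
    have hd : ∀ z ∈ connectedComponentIn A x,
        HasFDerivAt (fun y => inner ℝ (tangentProj u v y) w) (0 : E2 →L[ℝ] ℝ) z := fun z hz =>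
      have hzA := connectedComponentIn_subset _ _ hz
      hu.hasFDerivAt_inner_tangentProj hΩ (hAΩ hzA) (by
        filter_upwards [hA.mem_nhds hzA] with z hz using hr z hz)
        (hu.gradNormSq_ne_zero_on_component hΩ h0 (hsub hz)) v w
    exact hA.connectedComponentIn.is_const_of_fderiv_eq_zero isPreconnected_connectedComponentIn
      (fun z hz => (hd z hz).differentiableAt.differentiableWithinAt) (fun z hz => (hd z hz).fderiv)
      hy (mem_connectedComponentIn hx)

theorem IsInfHarmonicMap.gradParallel_of_component (hΩ : IsOpen Ω) (hu : IsInfHarmonicMap Ω u)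
    {A : Set E2} (hA : IsOpen A) (hAΩ : A ⊆ Ω) (hr : ∀ z ∈ A, gradRank u z ≤ 1)
    (hx : x ∈ A) (h0 : gradNormSq u x ≠ 0) (h1 : ‖ξ‖ = 1) (hξ : GradParallel u ξ x)
    (hy : y ∈ connectedComponentIn A x) : GradParallel u ξ y :=
  gradParallel_of_tangentProj_eq (hr y (connectedComponentIn_subset _ _ hy))
    (hu.gradNormSq_ne_zero_on_component hΩ h0 (connectedComponentIn_mono x hAΩ hy)) h1 fun v => by
      rw [hu.tangentProj_eq_of_component hΩ hA hAΩ hr hx hy, hξ.tangentProj_eq h1 h0]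

theorem IsInfHarmonicMap.sub_inner_smul_eq_of_component (hΩ : IsOpen Ω)
    (hu : IsInfHarmonicMap Ω u) {A : Set E2} (hA : IsOpen A) (hAΩ : A ⊆ Ω)
    (hr : ∀ z ∈ A, gradRank u z ≤ 1) (hx : x ∈ A) (h0 : gradNormSq u x ≠ 0) (h1 : ‖ξ‖ = 1)
    (hξ : GradParallel u ξ x) (hy : y ∈ connectedComponentIn A x) :
    u y - inner ℝ ξ (u y) • ξ = u x - inner ℝ ξ (u x) • ξ := by
  have hd : ∀ z ∈ connectedComponentIn A x,
      HasFDerivAt (fun z => u z - inner ℝ ξ (u z) • ξ) (0 : E2 →L[ℝ] EuclideanSpace ℝ (Fin N)) z := by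
    intro z hz
    have hdz : HasFDerivAt u (fderiv ℝ u z) z :=
      ((hu.1.differentiableOn (by norm_num)).differentiableAt
        (hΩ.mem_nhds (hAΩ (connectedComponentIn_subset _ _ hz)))).hasFDerivAt
    have hp := hu.gradParallel_of_component hΩ hA hAΩ hr hx h0 h1 hξ hz
    refine (hdz.sub (((innerSL ℝ ξ).hasFDerivAt.comp z hdz).smul_const ξ)).congr_fderiv ?_
    ext1 w
    exact sub_eq_zero.2 (hp w)
  exact hA.connectedComponentIn.is_const_of_fderiv_eq_zero isPreconnected_connectedComponentIn
    (fun z hz => (hd z hz).differentiableAt.differentiableWithinAt) (fun z hz => (hd z hz).fderiv)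
    hy (mem_connectedComponentIn hx)

/-- The offset a is written through the projection, without choosing ξ: this gives one function,
continuous wherever Du ≠ 0, that can be compared across different components of Ω₁. -/
theorem IsInfHarmonicMap.sub_tangentProj_eq_of_component (hΩ : IsOpen Ω)
    (hu : IsInfHarmonicMap Ω u) {A : Set E2} (hA : IsOpen A) (hAΩ : A ⊆ Ω)
    (hr : ∀ z ∈ A, gradRank u z ≤ 1) (hx : x ∈ A) (hy : y ∈ connectedComponentIn A x) :
    u y - tangentProj u (u y) y = u x - tangentProj u (u x) x := by
  have hsub := connectedComponentIn_mono x hAΩ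
  by_cases h0 : gradNormSq u x = 0
  · have hy0 := hu.gradNormSq_eq_zero_on_component hΩ (hAΩ hx) h0 y (hsub hy)
    simp [tangentProj, h0, hy0, hu.eq_on_component_of_gradNormSq_eq_zero hΩ (hAΩ hx) h0 y (hsub hy)]
  · obtain ⟨ξ, h1, hξ⟩ := exists_unit_of_gradRank_le_one (hr x hx) h0
    have hξ : GradParallel u ξ x := hξ
    rw [hξ.tangentProj_eq h1 h0,
      (hu.gradParallel_of_component hΩ hA hAΩ hr hx h0 h1 hξ hy).tangentProj_eq h1
        (hu.gradNormSq_ne_zero_on_component hΩ h0 (hsub hy))]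
    exact hu.sub_inner_smul_eq_of_component hΩ hA hAΩ hr hx h0 h1 hξ hy

/-- Essential scalarity passes to the boundary. -/
theorem gradParallel_of_mem_closure (hΩ : IsOpen Ω) (hu : ContDiffOn ℝ 2 u Ω) {V : Set E2}
    (hV : ∀ z ∈ V, GradParallel u ξ z) (hy : y ∈ Ω) (hyV : y ∈ closure V) : GradParallel u ξ y := by
  intro w
  have hc : ContinuousAt (fun z => fderiv ℝ u z w) y :=
    ((contDiffOn_fderiv_of_contDiffOn_two hΩ hu).continuousOn.continuousAt
      (hΩ.mem_nhds hy)).clm_apply continuousAt_const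
  have hF : ContinuousAt (fun z => fderiv ℝ u z w - inner ℝ ξ (fderiv ℝ u z w) • ξ) y :=
    Tendsto.sub hc (Tendsto.smul (Tendsto.inner tendsto_const_nhds hc) tendsto_const_nhds)
  exact sub_eq_zero.1 (eq_of_mem_closure_of_continuousAt
    (F := fun z => fderiv ℝ u z w - inner ℝ ξ (fderiv ℝ u z w) • ξ) hF hyV
    fun z hz => sub_eq_zero.2 (hV z hz w))

end Planar

/-! ### The structure theorem -/

theorem theorem1p1 (N : ℕ) (hN : 2 ≤ N) (Ω : Set (EuclideanSpace ℝ (Fin 2))) (hΩ : IsOpen Ω)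
    (u : EuclideanSpace ℝ (Fin 2) → EuclideanSpace ℝ (Fin N)) (hu : IsInfHarmonicMap Ω u) :
    ∃ Ω₁ Ω₂ S : Set (EuclideanSpace ℝ (Fin 2)),
      -- the decomposition of `Ω`
      IsOpen Ω₁ ∧ IsOpen Ω₂ ∧ (∃ C, IsClosed C ∧ S = Ω ∩ C) ∧ IsNowhereDense S ∧
      Disjoint Ω₁ Ω₂ ∧ Disjoint S (Ω₁ ∪ Ω₂) ∧ Ω = Ω₁ ∪ S ∪ Ω₂ ∧
      Ω₁ = interior {x | x ∈ Ω ∧ gradRank u x ≤ 1} ∧ Ω₂ = {x | x ∈ Ω ∧ gradRank u x = 2} ∧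
      -- the two-dimensional phase
      (∀ x ∈ Ω₂, gradRank u x = 2 ∧ Function.Injective (fderiv ℝ u x)) ∧
      (∀ x ∈ Ω₂, ∃ c : ℝ, 0 < c ∧ ∀ y ∈ connectedComponentIn Ω₂ x, gradNormSq u y = c ^ 2) ∧
      -- the one-dimensional phase
      (∀ x ∈ Ω₁, gradRank u x = 1 ∨ ∃ b, ∀ y ∈ connectedComponentIn Ω x, u y = b) ∧
      (∀ x ∈ Ω₁, ∃ (a ξ : EuclideanSpace ℝ (Fin N)) (f : EuclideanSpace ℝ (Fin 2) → ℝ),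
        ‖ξ‖ = 1 ∧ ContDiffOn ℝ 2 f Ω ∧
        (∀ y ∈ connectedComponentIn Ω₁ x, u y = a + f y • ξ ∧ scalarInfLaplacian f y = 0) ∧
        -- `u` is essentially scalar on the interface along this component of the one-dimensional phase
        (∀ y ∈ S ∩ frontier (connectedComponentIn Ω₁ x), EssentiallyScalarAt u a ξ f y) ∧
        (∀ z ∈ S, ∃ c : ℝ, 0 < c ∧
          ∀ y ∈ connectedComponentIn (Ω₂ ∪ S) z ∩ (S ∩ frontier (connectedComponentIn Ω₁ x)),
            gradNormSq f y = c ^ 2)) ∧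
      -- rank and gradient norm on the interface
      (∀ x ∈ S, gradRank u x = 1) ∧
      (∀ x ∈ S, ∃ c : ℝ, 0 < c ∧
        ∀ y ∈ connectedComponentIn (Ω₂ ∪ S) x, gradNormSq u y = c ^ 2) ∧
      -- if both phases meet everywhere on the interface: `u` on whole components of the interface
      (S = Ω ∩ (frontier Ω₁ ∩ frontier Ω₂) →
        (∀ z ∈ S, ∃ W ∈ 𝓝 z,
          {V | (∃ x ∈ Ω₁, V = connectedComponentIn Ω₁ x) ∧ (V ∩ W).Nonempty}.Finite) →
        ∀ z ∈ S, ∃ (a ξ : EuclideanSpace ℝ (Fin N)) (f : EuclideanSpace ℝ (Fin 2) → ℝ) (c : ℝ),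
          ‖ξ‖ = 1 ∧ ContDiffOn ℝ 2 f Ω ∧ 0 < c ∧
          ∀ y ∈ connectedComponentIn S z,
            EssentiallyScalarAt u a ξ f y ∧ gradNormSq f y = c ^ 2) := by
  set Ω₁ := interior {x | x ∈ Ω ∧ gradRank u x ≤ 1} with hΩ₁
  set Ω₂ := {x | x ∈ Ω ∧ gradRank u x = 2} with hΩ₂
  set S := Ω ∩ (Ω₁ ∪ Ω₂)ᶜ with hS
  have hO₁ : IsOpen Ω₁ := isOpen_interior
  have hO₂ : IsOpen Ω₂ := isOpen_gradRank_eq hΩ hu.1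
  have h₁Ω : Ω₁ ⊆ Ω := fun x hx => (interior_subset hx).1
  have hr₁ : ∀ x ∈ Ω₁, gradRank u x ≤ 1 := fun x hx => (interior_subset hx).2
  have hrS : ∀ x ∈ S, gradRank u x ≤ 1 := fun x hx => by
    have h1 := gradRank_le (u := u) (x := x)
    have h2 : gradRank u x ≠ 2 := fun h => hx.2 (Or.inr ⟨hx.1, h⟩)
    omega
  have hSΩ : S ⊆ Ω := inter_subset_left
  have h2SΩ : Ω₂ ∪ S ⊆ Ω := union_subset (fun x hx => hx.1) hSΩ
  have hdiff : ∀ x ∈ Ω, DifferentiableAt ℝ u x := fun z hz =>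
    (hu.1.differentiableOn (by norm_num)).differentiableAt (hΩ.mem_nhds hz)
  have hzero : ∀ x ∈ Ω, gradNormSq u x = 0 → x ∈ Ω₁ := fun x hx h0 => by
    refine mem_interior_iff_mem_nhds.2 ?_
    filter_upwards [hΩ.mem_nhds hx, hu.eventually_gradNormSq_eq_zero hΩ hx h0] with y hy hy0
    exact ⟨hy, (gradRank_eq_zero_iff.2 hy0).le.trans zero_le_one⟩
  have hdisj : Disjoint Ω₁ Ω₂ := Set.disjoint_left.2 fun x h1 h2 => by
    have := hr₁ x h1
    have := h2.2
    omega
  have hne : ∀ x ∈ Ω₂ ∪ S, gradNormSq u x ≠ 0 := by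
    rintro x (hx | hx) h0
    · exact Set.disjoint_left.1 hdisj (hzero x hx.1 h0) hx
    · exact hx.2 (Or.inl (hzero x hx.1 h0))
  -- A point of Ω away from closure Ω₂ has a neighbourhood of rank at most one, so it lies in Ω₁.
  have hScl : S ⊆ closure Ω₂ := fun x hx => by
    by_contra hcl
    refine hx.2 (Or.inl (mem_interior_iff_mem_nhds.2 ?_))
    filter_upwards [hΩ.mem_nhds hx.1, isClosed_closure.isOpen_compl.mem_nhds hcl] with y hy hy2
    have h1 := gradRank_le (u := u) (x := y)
    have h2 : gradRank u y ≠ 2 := fun h => hy2 (subset_closure ⟨hy, h⟩)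
    exact ⟨hy, by omega⟩
  have hcrit₂ : ∀ x ∈ Ω₂, fderiv ℝ (gradNormSq u) x = 0 := fun x hx =>
    hu.fderiv_gradNormSq_eq_zero hΩ hx.1 hx.2
  have hcrit : ∀ x ∈ Ω₂ ∪ S, fderiv ℝ (gradNormSq u) x = 0 := by
    rintro x (hx | hx)
    · exact hcrit₂ x hx
    · exact eq_of_mem_closure_of_continuousAt
        (((contDiffOn_gradNormSq hΩ hu.1).continuousOn_fderiv_of_isOpen hΩ le_rfl).continuousAt
          (hΩ.mem_nhds hx.1)) (hScl hx) hcrit₂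
  have hconst : ∀ A ⊆ Ω₂ ∪ S, ∀ x ∈ A, ∃ c : ℝ, 0 < c ∧
      ∀ y ∈ connectedComponentIn A x, gradNormSq u y = c ^ 2 := by
    intro A hA x hx
    have hpos : 0 < gradNormSq u x :=
      lt_of_le_of_ne (gradNormSq_nonneg u x) (hne x (hA hx)).symm
    refine ⟨√(gradNormSq u x), Real.sqrt_pos.2 hpos, fun y hy => ?_⟩
    rw [Real.sq_sqrt hpos.le]
    have hsub := (connectedComponentIn_subset A x).trans hA
    exact hu.gradNormSq_eq_of_isPreconnected hΩ isPreconnected_connectedComponentIn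
      (hsub.trans h2SΩ) (fun z hz => hcrit z (hsub hz)) (fun z hz => hne z (hsub hz)) hy
      (mem_connectedComponentIn hx)
  have hcdf : ∀ ξ : EuclideanSpace ℝ (Fin N), ContDiffOn ℝ 2 (fun z => inner ℝ ξ (u z)) Ω :=
    fun ξ => contDiffOn_const.inner ℝ hu.1
  refine ⟨Ω₁, Ω₂, S, hO₁, hO₂, ⟨_, (hO₁.union hO₂).isClosed_compl, rfl⟩, ?_, hdisj, ?_, ?_, rfl,
    rfl, fun x hx => ⟨hx.2, injective_fderiv_iff.2 hx.2⟩, hconst Ω₂ subset_union_left, ?_, ?_, ?_,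
    fun x hx => hconst _ subset_rfl x (Or.inr hx), ?_⟩
  · rw [IsNowhereDense, eq_empty_iff_forall_notMem]
    intro x hx
    obtain ⟨y, hyI, hyS⟩ := mem_closure_iff_nhds.1 (interior_subset hx) _
      (isOpen_interior.mem_nhds hx)
    obtain ⟨z, ⟨hzI, -⟩, hz2⟩ := mem_closure_iff_nhds.1 (hScl hyS) _
      (Filter.inter_mem (isOpen_interior.mem_nhds hyI) (hΩ.mem_nhds hyS.1))
    obtain ⟨w, hw2, hwS⟩ := mem_closure_iff_nhds.1 (interior_subset hzI) _ (hO₂.mem_nhds hz2)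
    exact hwS.2 (Or.inr hw2)
  · exact Set.disjoint_left.2 fun x hx h => hx.2 h
  · ext x
    constructor
    · intro hx
      by_cases h1 : x ∈ Ω₁
      · exact Or.inl (Or.inl h1)
      · by_cases h2 : x ∈ Ω₂
        · exact Or.inr h2
        · exact Or.inl (Or.inr ⟨hx, fun h => h.elim h1 h2⟩)
    · rintro ((h | h) | h)
      exacts [h₁Ω h, h.1, h.1]
  · intro x hx
    by_cases h0 : gradNormSq u x = 0
    · exact Or.inr ⟨u x, hu.eq_on_component_of_gradNormSq_eq_zero hΩ (h₁Ω hx) h0⟩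
    · have h1 := hr₁ x hx
      have h2 := mt gradRank_eq_zero_iff.1 h0
      exact Or.inl (by omega)
  · intro x hx
    have hfr : ∀ y ∈ S ∩ frontier (connectedComponentIn Ω₁ x),
        y ∈ closure (connectedComponentIn Ω₁ x) := fun y hy => frontier_subset_closure hy.2
    by_cases h0 : gradNormSq u x = 0
    · have hempty : ∀ y ∈ S ∩ frontier (connectedComponentIn Ω₁ x), False := by
        intro y hy
        refine hne y (Or.inr hy.1) (eq_of_mem_closure_of_continuousAt
          ((contDiffOn_gradNormSq hΩ hu.1).continuousOn.continuousAt (hΩ.mem_nhds hy.1.1))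
          (hfr y hy) fun z hz => hu.gradNormSq_eq_zero_on_component hΩ (h₁Ω hx) h0 z
            (connectedComponentIn_mono x h₁Ω hz))
      -- Here u is constant on the component and its boundary misses S, so any unit vector serves as
      -- ξ, with f = 0.
      refine ⟨u x, EuclideanSpace.single ⟨0, by omega⟩ 1, fun _ => 0, by simp, contDiffOn_const,
        fun y hy => ⟨?_, ?_⟩, fun y hy => (hempty y hy).elim,
        fun z _ => ⟨1, one_pos, fun y hy => (hempty y hy.2).elim⟩⟩
      · simp [hu.eq_on_component_of_gradNormSq_eq_zero hΩ (h₁Ω hx) h0 y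
          (connectedComponentIn_mono x h₁Ω hy)]
      · simp [scalarInfLaplacian, partialD]
    · obtain ⟨ξ, h1, hξ⟩ := exists_unit_of_gradRank_le_one (hr₁ x hx) h0
      have hpar : ∀ y ∈ connectedComponentIn Ω₁ x, GradParallel u ξ y := fun y hy =>
        hu.gradParallel_of_component hΩ hO₁ h₁Ω hr₁ hx h0 h1 hξ hy
      have hval : ∀ y ∈ connectedComponentIn Ω₁ x,
          u y - inner ℝ ξ (u y) • ξ = u x - inner ℝ ξ (u x) • ξ := fun y hy =>
        hu.sub_inner_smul_eq_of_component hΩ hO₁ h₁Ω hr₁ hx h0 h1 hξ hy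
      have hparS : ∀ y ∈ S ∩ frontier (connectedComponentIn Ω₁ x), GradParallel u ξ y :=
        fun y hy => gradParallel_of_mem_closure hΩ hu.1 hpar hy.1.1 (hfr y hy)
      -- Taking f = ⟨ξ,u⟩ makes f of class C² on all of Ω, and the identities on V extend to its
      -- boundary by continuity.
      refine ⟨u x - inner ℝ ξ (u x) • ξ, ξ, fun z => inner ℝ ξ (u z), h1, hcdf ξ,
        fun y hy => ⟨?_, ?_⟩, fun y hy => ?_, fun z hz => ?_⟩
      · rw [← hval y hy]; simp
      · exact hu.scalarInfLaplacian_component hΩ (h₁Ω (connectedComponentIn_subset _ _ hy))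
          (hpar y hy)
      · refine (hparS y hy).essentiallyScalarAt (hdiff y hy.1.1)
          (eq_of_mem_closure_of_continuousAt (F := fun y => u y - inner ℝ ξ (u y) • ξ) ?_
            (hfr y hy) hval)
        have hc := (hdiff y hy.1.1).continuousAt
        exact Tendsto.sub hc (Tendsto.smul (Tendsto.inner tendsto_const_nhds hc) tendsto_const_nhds)
      · obtain ⟨c, hc, hcK⟩ := hconst _ subset_rfl z (Or.inr hz)
        refine ⟨c, hc, fun y hy => ?_⟩
        rw [(hparS y hy.2).gradNormSq_component h1 (hdiff y hy.2.1.1), hcK y hy.1]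
  · intro x hx
    have h1 := hrS x hx
    have h2 := mt gradRank_eq_zero_iff.1 (hne x (Or.inr hx))
    omega
  · intro hSf hfin z hz
    have hSc₁ : S ⊆ closure Ω₁ := fun y hy => by
      rw [hSf] at hy
      exact frontier_subset_closure hy.2.1
    -- Each component of Ω₁ contributes one value, so F takes locally finitely many values on S.
    -- Applied to the projection and to the offset.
    have hgen : ∀ F : EuclideanSpace ℝ (Fin 2) → EuclideanSpace ℝ (Fin N),
        (∀ y ∈ S, ContinuousAt F y) →
        (∀ x ∈ Ω₁, ∀ y ∈ connectedComponentIn Ω₁ x, F y = F x) →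
        ∀ y ∈ connectedComponentIn S z, F y = F z := by
      intro F hF hFc y hy
      refine isPreconnected_connectedComponentIn.eq_of_locally_finite_image
        (connectedComponentIn_subset S z) (fun y hy => (hF y hy).continuousWithinAt)
        (fun p hp => ?_) hy (mem_connectedComponentIn hz)
      obtain ⟨W, hW, hWfin⟩ := hfin p hp
      exact ⟨interior W, interior_mem_nhds.2 hW,
        finite_image_of_finite_components hF hSc₁ hFc hWfin⟩
    have hproj : ∀ v, ∀ y ∈ connectedComponentIn S z, tangentProj u v y = tangentProj u v z :=
      fun v => hgen _ (fun y hy => continuousAt_tangentProj hΩ hu.1 hy.1 (hne y (Or.inr hy))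
        continuousAt_const)
        fun x hx y hy => hu.tangentProj_eq_of_component hΩ hO₁ h₁Ω hr₁ hx hy v
    have hrem := hgen (fun y => u y - tangentProj u (u y) y)
      (fun y hy => (hdiff y hy.1).continuousAt.sub (continuousAt_tangentProj hΩ hu.1 hy.1
        (hne y (Or.inr hy)) (hdiff y hy.1).continuousAt))
      fun x hx y hy => hu.sub_tangentProj_eq_of_component hΩ hO₁ h₁Ω hr₁ hx hy
    have hz0 := hne z (Or.inr hz)
    obtain ⟨ξ, h1, hξ⟩ := exists_unit_of_gradRank_le_one (hrS z hz) hz0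
    have hξ : GradParallel u ξ z := hξ
    obtain ⟨c, hc, hcK⟩ := hconst _ subset_rfl z (Or.inr hz)
    refine ⟨u z - inner ℝ ξ (u z) • ξ, ξ, fun y => inner ℝ ξ (u y), c, h1, hcdf ξ, hc,
      fun y hy => ?_⟩
    have hyS := connectedComponentIn_subset _ _ hy
    have hy0 := hne y (Or.inr hyS)
    have hpar : GradParallel u ξ y := gradParallel_of_tangentProj_eq (hrS y hyS) hy0 h1 fun v => by
      rw [hproj v y hy, hξ.tangentProj_eq h1 hz0]
    refine ⟨hpar.essentiallyScalarAt (hdiff y hyS.1) ?_, ?_⟩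
    · have := hrem y hy
      simpa only [hpar.tangentProj_eq h1 hy0, hξ.tangentProj_eq h1 hz0] using this
    · rw [hpar.gradNormSq_component h1 (hdiff y hyS.1)]
      exact hcK y (connectedComponentIn_mono z subset_union_right hy)
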